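/- Let $N,p\ge 0$ be integers, $T>0$, let $\mathcal M,\mathcal C,\mathcal K\in\mathbb R^{N\times N}$ with $\mathcal M$ symmetric positive definite, $\mathcal B\in\mathbb R^{N\times p}$, and let $X_0,X_1\in\mathbb R^N$, $\mathcal F\in L^2(]0,T[;\mathbb R^N)$. For a control $v\in[H^1_0(]0,T[)]^p$ let $X$ be the $H^2$ solution of $$\mathcal M\ddot X+\mathcal C\dot X+\mathcal K X=\mathcal F+\mathcal B v,\qquad X(0)=X_0,\ \dot X(0)=X_1 .$$ The control $v$ is called exact if $X(T)=\dot X(T)=0$. Assume exact controllability at time $T$: for all $X_0,X_1\in\mathbb R^N$ and all $\mathcal F\in L^2(]0,T[;\mathbb R^N)$ there is an exact control in $[H^1_0(]0,T[)]^p$. Let $\alpha\ge0$, $\beta>0$, $\gamma>0$ and put, with Euclidean norms $|\cdot|$ and scalar products $(\cdot,\cdot)$, $$c(v)=\int_0^T \alpha|v|^2+\beta|v'|^2+2\gamma|v'|\,dt,\qquad J^{\varepsilon,\alpha,\beta,\gamma}(v)=\tfrac12\Big(|X(T)|^2+|\dot X(T)|^2+\varepsilon\, c(v)\Big)\quad(\varepsilon>0).$$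 For $\Psi=(\Psi_0,\Psi_1)\in\mathbb R^{2N}$ let $Q(\Psi)$ be the solution of $\mathcal M\ddot Q-{}^t\mathcal C\dot Q+{}^t\mathcal K Q=0$, $Q(0)=\Psi_0$, $\dot Q(0)=\Psi_1$, and let $u(\Psi)\in[H^1_0(]0,T[)]^p$ be the function for which there is $\lambda\in[L^\infty(]0,T[)]^p$ such that $$\int_0^T\alpha(u(\Psi),v)+\beta(u(\Psi)',v')+\gamma(\lambda,v')\,dt=-\int_0^T({}^t\mathcal B Q(\Psi),v)\,dt\qquad\forall v\in[H^1_0(]0,T[)]^p,$$ and such that for almost every $t$ one has $|\lambda(t)|\le1$ and $(\mu-\lambda(t),u(\Psi)'(t))\le0$ for all $\mu\in\mathbb R^p$ with $|\mu|\le1$. Define $\Lambda:\mathbb R^{2N}\to\mathbb R^{2N}$ and $L\in\mathbb R^{2N}$ by $$(\Lambda(\Psi),\delta)=-\int_0^T({}^t\mathcal B Q(\delta),u(\Psi))\,dt,\qquad (L,\delta)=\int_0^T(\mathcal F,Q(\delta))\,dt+(\mathcal M X_1+\mathcal C X_0,\delta_0)-(\mathcal M X_0,\delta_1)$$ for all $\Psi$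 and all $\delta=(\delta_0,\delta_1)$ in $\mathbb R^{2N}$. Then the following hold. 1. The state equation, the equation for $Q(\Psi)$ and the problem defining $u(\Psi)$ each determine $X$ (on $[0,T]$), $Q(\Psi)$ and $u(\Psi)$ uniquely, so that all these objects, $\Lambda$ and $L$ are well defined; and for every $\varepsilon>0$ the criterion $J^{\varepsilon,\alpha,\beta,\gamma}$ has exactly one minimizer $u^\varepsilon$ in $[H^1_0(]0,T[)]^p$. 2. The equation $\Lambda(\Phi)=L$ has a solution $\Phi\in\mathbb R^{2N}$, and $u^0:=u(\Phi)$ is the same for every solution $\Phi$. 3. $u^0$ is an exact control, and it is the unique minimizer of $c$ among all exact controls. 4. As $\varepsilon\to0^+$, $u^\varepsilon\to u^0$ strongly in $[H^1_0(]0,T[)]^p$. -/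

import Mathlib

open MeasureTheory Filter Topology Set
open scoped ContDiff

/-- `ℝⁿ` with its Euclidean norm and scalar product. -/
abbrev Vec (n : ℕ) : Type := EuclideanSpace ℝ (Fin n)

/-- Lebesgue measure on the open interval `]0,T[`. -/
noncomputable abbrev timeMeasure (T : ℝ) : Measure ℝ := volume.restrict (Ioo 0 T)

/-- `[L²(]0,T[)]ⁿ`. -/
abbrev L2 (T : ℝ) (n : ℕ) : Type := Lp (Vec n) 2 (timeMeasure T)

/-- The pairs `(φ, φ')` in `[L²]ⁿ × [L²]ⁿ`, with `φ` a smooth function whose support is a compact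
subset of `]0,T[`. -/
def testPairs (T : ℝ) (n : ℕ) : Set (WithLp 2 (L2 T n × L2 T n)) :=
  {w | ∃ φ : ℝ → Vec n, ContDiff ℝ ∞ φ ∧ HasCompactSupport φ ∧ tsupport φ ⊆ Ioo 0 T ∧
    w.fst =ᵐ[timeMeasure T] φ ∧ w.snd =ᵐ[timeMeasure T] deriv φ}

/-- The Sobolev space `[H¹₀(]0,T[)]ⁿ`: the closure of the test functions for the norm
`(‖u‖² + ‖u'‖²)^(1/2)`. An element is stored as the pair `(u, u')` of the function and its weak
derivative; the topology and the Hilbert space structure are those of `H¹`. -/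
noncomputable def H10 (T : ℝ) (n : ℕ) : Submodule ℝ (WithLp 2 (L2 T n × L2 T n)) :=
  (Submodule.span ℝ (testPairs T n)).topologicalClosure

/-- The function underlying an element of `H¹₀`. -/
noncomputable def H10val {T : ℝ} {n : ℕ} (u : H10 T n) : L2 T n :=
  (u : WithLp 2 (L2 T n × L2 T n)).fst

/-- The weak derivative of an element of `H¹₀`. -/
noncomputable def H10deriv {T : ℝ} {n : ℕ} (u : H10 T n) : L2 T n :=
  (u : WithLp 2 (L2 T n × L2 T n)).snd

/-- A linear second order system `M Ẍ + C Ẋ + K X = F + B u` on `[0,T]`, with `M` symmetric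
positive definite. -/
structure ControlSystem (N p : ℕ) where
  T : ℝ
  T_pos : 0 < T
  M : Matrix (Fin N) (Fin N) ℝ
  C : Matrix (Fin N) (Fin N) ℝ
  K : Matrix (Fin N) (Fin N) ℝ
  B : Matrix (Fin N) (Fin p) ℝ
  M_posDef : M.PosDef

/-- The external load and the initial position and velocity. -/
structure LoadData (T : ℝ) (N : ℕ) where
  F : L2 T N
  X₀ : Vec N
  X₁ : Vec N

namespace ControlSystem

variable {N p : ℕ} (S : ControlSystem N p)

/-- The space `[H¹₀(]0,T[)]^p` of controls. -/
abbrev Control : Type := H10 S.T p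

/-- `X` is the `H²` solution on `[0,T]` of the state equation with control `u`, and `V` is its
velocity: `X' = V` and `V' = A` with `A ∈ L²`, in integrated form, and the equation holds a.e. -/
def IsState (D : LoadData S.T N) (u : S.Control) (X V : ℝ → Vec N) : Prop :=
  ∃ A : L2 S.T N,
    (∀ t ∈ Icc 0 S.T, X t = D.X₀ + ∫ s in (0 : ℝ)..t, V s) ∧
    (∀ t ∈ Icc 0 S.T, V t = D.X₁ + ∫ s in (0 : ℝ)..t, A s) ∧
    ∀ᵐ t ∂(timeMeasure S.T),
      S.M.toEuclideanLin (A t) + S.C.toEuclideanLin (V t) + S.K.toEuclideanLin (X t)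
        = D.F t + S.B.toEuclideanLin (H10val u t)

/-- The pair `(X, Ẋ)` produced by the control `u`. -/
noncomputable def state (D : LoadData S.T N) (u : S.Control) : (ℝ → Vec N) × (ℝ → Vec N) :=
  Classical.epsilon fun Z => S.IsState D u Z.1 Z.2

/-- The control `u` is exact: it steers the system to `X(T) = Ẋ(T) = 0`. -/
def IsExactControl (D : LoadData S.T N) (u : S.Control) : Prop :=
  ∃ X V : ℝ → Vec N, S.IsState D u X V ∧ X S.T = 0 ∧ V S.T = 0

/-- Exact controllability at time `T`. -/
def ExactlyControllable : Prop :=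
  ∀ D : LoadData S.T N, ∃ u : S.Control, S.IsExactControl D u

/-- The marginal cost `∫₀ᵀ α|v|² + β|v'|² + 2γ|v'|`. -/
noncomputable def cost (α β γ : ℝ) (v : S.Control) : ℝ :=
  ∫ t, (α * ‖H10val v t‖ ^ 2 + β * ‖H10deriv v t‖ ^ 2 + 2 * γ * ‖H10deriv v t‖) ∂(timeMeasure S.T)

/-- The criterion `J^{ε,α,β,γ}`. -/
noncomputable def criterion (D : LoadData S.T N) (ε α β γ : ℝ) (v : S.Control) : ℝ :=
  (1 / 2) * (‖(S.state D v).1 S.T‖ ^ 2 + ‖(S.state D v).2 S.T‖ ^ 2 + ε * S.cost α β γ v)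

/-- `u` minimizes `J^{ε,α,β,γ}` over `[H¹₀(]0,T[)]^p`. -/
def IsOptimal (D : LoadData S.T N) (ε α β γ : ℝ) (u : S.Control) : Prop :=
  ∀ v : S.Control, S.criterion D ε α β γ u ≤ S.criterion D ε α β γ v

/-- `Q` solves `M Q̈ - ᵗC Q̇ + ᵗK Q = 0`, `Q(0) = Ψ₀`, `Q̇(0) = Ψ₁` (on the whole line, where the
solution of this constant coefficient equation extends). -/
def IsAdjoint (Ψ : WithLp 2 (Vec N × Vec N)) (Q : ℝ → Vec N) : Prop :=
  ContDiff ℝ 2 Q ∧ Q 0 = Ψ.fst ∧ deriv Q 0 = Ψ.snd ∧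
    ∀ t, S.M.toEuclideanLin (deriv (deriv Q) t) - S.C.transpose.toEuclideanLin (deriv Q t)
      + S.K.transpose.toEuclideanLin (Q t) = 0

/-- The adjoint state `Q(Ψ)`. -/
noncomputable def adjointState (Ψ : WithLp 2 (Vec N × Vec N)) : ℝ → Vec N :=
  Classical.epsilon (S.IsAdjoint Ψ)

/-- The pairing `∫₀ᵀ (ᵗB Q(Ψ), v)`. -/
noncomputable def adjointPairing (Ψ : WithLp 2 (Vec N × Vec N)) (v : S.Control) : ℝ :=
  ∫ t, inner ℝ (S.B.transpose.toEuclideanLin (S.adjointState Ψ t)) (H10val v t) ∂(timeMeasure S.T)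

/-- `(u, lam)` solves the mixed problem with data `Ψ`: for all `v ∈ [H¹₀]^p`,
`∫ α(u,v) + β(u',v') + γ(lam,v') = -∫ (ᵗB Q(Ψ), v)`, and for a.e. `t`, `lam` is in the closed unit
ball `B₁` of `ℝ^p` and `(μ - lam, u') ≤ 0` for all `μ ∈ B₁`. -/
def IsMixedSolution (α β γ : ℝ) (Ψ : WithLp 2 (Vec N × Vec N))
    (u : S.Control) (lam : Lp (Vec p) ⊤ (timeMeasure S.T)) : Prop :=
  (∀ v : S.Control,
    ∫ t, (α * inner ℝ (H10val u t) (H10val v t) + β * inner ℝ (H10deriv u t) (H10deriv v t)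
      + γ * inner ℝ (lam t) (H10deriv v t)) ∂(timeMeasure S.T) = - S.adjointPairing Ψ v) ∧
  ∀ᵐ t ∂(timeMeasure S.T), ‖lam t‖ ≤ 1 ∧
    ∀ μ : Vec p, ‖μ‖ ≤ 1 → inner ℝ (μ - lam t) (H10deriv u t) ≤ 0

/-- The control `u(Ψ)`. -/
noncomputable def controlOf (α β γ : ℝ) (Ψ : WithLp 2 (Vec N × Vec N)) : S.Control :=
  Classical.epsilon fun u => ∃ lam, S.IsMixedSolution α β γ Ψ u lam

/-- `Λ` is the operator of `ℝ^{2N}` with `(Λ(Ψ), δ) = -∫₀ᵀ (ᵗB Q(δ), u(Ψ))` for all `δ`. -/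
def IsLambda (α β γ : ℝ)
    (Λ : WithLp 2 (Vec N × Vec N) → WithLp 2 (Vec N × Vec N)) : Prop :=
  ∀ Ψ δ, inner ℝ (Λ Ψ) δ = - S.adjointPairing δ (S.controlOf α β γ Ψ)

/-- `L` is the vector of `ℝ^{2N}` with
`(L, δ) = ∫₀ᵀ (F, Q(δ)) + (M X₁ + C X₀, δ₀) - (M X₀, δ₁)` for all `δ = (δ₀, δ₁)`. -/
def IsLoadVector (D : LoadData S.T N) (L : WithLp 2 (Vec N × Vec N)) : Prop :=
  ∀ δ : WithLp 2 (Vec N × Vec N),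
    inner ℝ L δ = (∫ t, inner ℝ (D.F t) (S.adjointState δ t) ∂(timeMeasure S.T))
      + inner ℝ (S.M.toEuclideanLin D.X₁ + S.C.toEuclideanLin D.X₀) δ.fst
      - inner ℝ (S.M.toEuclideanLin D.X₀) δ.snd

end ControlSystem

/-! Write `P` for `reach`, so that `(P v, δ) = -∫ (ᵗB Q(δ), v)` and `Λ(Ψ) = P (u(Ψ))`. Integrating
the state equation by parts against `Q(δ)` gives `P v - L = terminal (X(T), Ẋ(T))` with `terminal`
injective and independent of the data (`IsState.reach_sub`). The exact controls are therefore the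
closed affine set `P v = L`.

Poincaré's inequality makes the cost `c` strongly convex, so `c` has a unique minimizer `u₀` on this
set, which exact controllability makes nonempty. The mixed problem is the Euler equation of `½ c -
(Ψ, P ·)`, with `λ` a subgradient of the norm along `u'`. What remains is to find a multiplier `Φ`
with `u₀ = u(Φ)` although `c` is not differentiable. Minimality bounds the Euler residual on `ker P`
by the increment of the `L¹` norm at `u₀'`; Hahn–Banach extends it to `L²`, where it is represented
by a field `λ` (`exists_multiplier`). The Euler form with this `λ` vanishes on `ker P`, hence
factors through the finite-dimensional range of `P`, and this yields `Φ`
(`exists_mixed_of_minimal_cost`).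

Everything else follows from the quadratic growth of `½ c - (Ψ, P ·)` around `u(Ψ)`
(`IsMixedSolution.growth`): uniqueness, independence of the choice of `Φ`, and strong convergence.
For the last, comparing `J(u^ε)` with `J(u₀)` gives `c(u^ε) ≤ c(u₀)` and a final state of size
`O(√ε)`; growth around `u₀ = u(Φ)` then bounds the energy of `u^ε - u₀` by `O(√ε)`, without any weak
compactness. -/

/-! ### Convex analysis: minimizers and a Hahn–Banach extension. -/

/-- A continuous function that is strongly convex at midpoints and bounded below attains its
minimum over a closed convex set. -/
theorem exists_minimizer_of_midpoint {H : Type*} [NormedAddCommGroup H] [NormedSpace ℝ H]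
    [CompleteSpace H] {K : Set H} (hKc : IsClosed K) (hK : Convex ℝ K) (hne : K.Nonempty)
    {f : H → ℝ} (hf : Continuous f) {b : ℝ} (hb : ∀ x ∈ K, b ≤ f x) {m : ℝ} (hm : 0 < m)
    (hmid : ∀ x ∈ K, ∀ y ∈ K,
      f ((1 / 2 : ℝ) • x + (1 / 2 : ℝ) • y) ≤ (f x + f y) / 2 - m * ‖x - y‖ ^ 2) :
    ∃ x ∈ K, ∀ y ∈ K, f x ≤ f y := by
  set I := sInf (f '' K) with hI
  have hbdd : BddBelow (f '' K) := ⟨b, by rintro _ ⟨x, hx, rfl⟩; exact hb x hx⟩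
  have hle : ∀ x ∈ K, I ≤ f x := fun x hx => csInf_le hbdd ⟨x, hx, rfl⟩
  have hex : ∀ n : ℕ, ∃ x ∈ K, f x < I + 1 / ((n : ℝ) + 1) := by
    intro n
    obtain ⟨_, ⟨x, hx, rfl⟩, h⟩ :=
      exists_lt_of_csInf_lt (hne.image f) (show sInf (f '' K) < I + 1 / ((n : ℝ) + 1) by
        rw [← hI]; have : (0 : ℝ) < 1 / ((n : ℝ) + 1) := by positivity
        linarith)
    exact ⟨x, hx, h⟩
  choose x hxK hx using hex
  -- The midpoint value is at least the infimum, while the average of the two values exceeds it by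
  -- at most `1 / (N + 1)`; the strong convexity term absorbs the gap, so minimizing sequences are
  -- Cauchy.
  have hdist : ∀ i j N : ℕ, N ≤ i → N ≤ j →
      dist (x i) (x j) ≤ Real.sqrt (1 / ((N : ℝ) + 1) / m) := by
    intro i j N hi hj
    have hk : ∀ k : ℕ, N ≤ k → 1 / ((k : ℝ) + 1) ≤ 1 / ((N : ℝ) + 1) := by
      intro k hk
      have : (N : ℝ) ≤ k := by exact_mod_cast hk
      gcongr
    have h1 := hmid _ (hxK i) _ (hxK j)
    have h2 := hle _ (hK (hxK i) (hxK j) (by norm_num : (0 : ℝ) ≤ 1 / 2)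
      (by norm_num : (0 : ℝ) ≤ 1 / 2) (by norm_num))
    have h3 := hx i
    have h4 := hx j
    have h5 := hk i hi
    have h6 := hk j hj
    rw [dist_eq_norm]
    apply Real.le_sqrt_of_sq_le
    rw [le_div_iff₀ hm]
    linarith
  have hlim : Tendsto (fun N : ℕ => Real.sqrt (1 / ((N : ℝ) + 1) / m)) atTop (𝓝 0) := by
    have h1 := (tendsto_one_div_add_atTop_nhds_zero_nat (𝕜 := ℝ)).div_const m
    have h2 := (Real.continuous_sqrt.tendsto _).comp h1
    rw [zero_div, Real.sqrt_zero] at h2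
    exact h2
  have hcau : CauchySeq x := cauchySeq_of_le_tendsto_0 _ hdist hlim
  obtain ⟨z, hz⟩ := cauchySeq_tendsto_of_complete hcau
  have hzK : z ∈ K := hKc.mem_of_tendsto hz (Eventually.of_forall hxK)
  refine ⟨z, hzK, fun y hy => le_trans ?_ (hle y hy)⟩
  have h1 := (hf.tendsto z).comp hz
  have h2 : Tendsto (fun n : ℕ => I + 1 / ((n : ℝ) + 1)) atTop (𝓝 I) := by
    simpa using (tendsto_one_div_add_atTop_nhds_zero_nat (𝕜 := ℝ)).const_add I
  exact le_of_tendsto_of_tendsto' h1 h2 fun n => (hx n).le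

/-- Hahn–Banach extension of a linear functional dominated by a convex function vanishing at
the origin. -/
theorem exists_extension_of_le_convex {E : Type*} [AddCommGroup E] [Module ℝ E]
    (f : E →ₗ.[ℝ] ℝ) (q : E → ℝ) (hq0 : q 0 = 0) (hq : ConvexOn ℝ univ q)
    (hf : ∀ x : f.domain, f x ≤ q x) :
    ∃ g : E →ₗ[ℝ] ℝ, (∀ x : f.domain, g x = f x) ∧ ∀ x, g x ≤ q x := by
  -- Convexity along `-x`, `0`, `t • x` bounds the quotients `q (t • x) / t` below, so the infimum
  -- defining `N` is finite.
  have key : ∀ x : E, ∀ t : ℝ, 0 < t → -q (-x) ≤ q (t • x) / t := by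
    intro x t ht
    have h := hq.2 (mem_univ (-x)) (mem_univ (t • x)) (by positivity : 0 ≤ t / (1 + t))
      (by positivity : 0 ≤ 1 / (1 + t)) (by field_simp; ring)
    have h0 : (t / (1 + t)) • (-x) + (1 / (1 + t)) • (t • x) = 0 := by
      rw [smul_smul, smul_neg, one_div_mul_eq_div]; simp
    rw [h0, hq0] at h
    simp only [smul_eq_mul] at h
    rw [le_div_iff₀ ht]
    have h2 : 0 ≤ (1 + t) * (t / (1 + t) * q (-x) + 1 / (1 + t) * q (t • x)) := by positivity
    have h3 : (1 + t) * (t / (1 + t) * q (-x) + 1 / (1 + t) * q (t • x))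
        = t * q (-x) + q (t • x) := by field_simp
    linarith
  -- `N` is the largest sublinear function below `q`. A linear functional dominated by `q` is
  -- dominated by `N`, which reduces the claim to the sublinear Hahn–Banach theorem.
  let N : E → ℝ := fun x => ⨅ t : Ioi (0 : ℝ), q ((t : ℝ) • x) / t
  have hbdd : ∀ x, BddBelow (range fun t : Ioi (0 : ℝ) => q ((t : ℝ) • x) / t) := fun x =>
    ⟨-q (-x), by rintro _ ⟨t, rfl⟩; exact key x t t.2⟩
  have hNle : ∀ x (t : ℝ), 0 < t → N x ≤ q (t • x) / t := fun x t ht =>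
    ciInf_le (hbdd x) (⟨t, ht⟩ : Ioi (0 : ℝ))
  have : Nonempty (Ioi (0 : ℝ)) := ⟨⟨1, zero_lt_one (α := ℝ)⟩⟩
  have hom_le : ∀ c : ℝ, 0 < c → ∀ x, N (c • x) ≤ c * N x := by
    intro c hc x
    rw [← div_le_iff₀' hc]
    refine le_ciInf fun t => ?_
    have ht : (0 : ℝ) < t := t.2
    rw [div_le_iff₀' hc]
    refine (hNle (c • x) (t / c) (by positivity)).trans (le_of_eq ?_)
    rw [smul_smul, div_mul_cancel₀ _ hc.ne']
    field_simp
  obtain ⟨g, hg, hgN⟩ := exists_extension_of_le_sublinear f N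
    (fun c hc x => by
      refine le_antisymm (hom_le c hc x) ?_
      have h := hom_le c⁻¹ (by positivity) (c • x)
      rw [smul_smul, inv_mul_cancel₀ hc.ne', one_smul] at h
      rwa [← div_eq_inv_mul, le_div_iff₀' hc] at h)
    (fun x y => by
      refine le_ciInf_add_ciInf fun s r => ?_
      have hs : (0 : ℝ) < s := s.2
      have hr : (0 : ℝ) < r := r.2
      -- The weights are chosen so that `x` and `y` receive the same factor `s r / (s + r)`.
      have h := hq.2 (mem_univ ((s : ℝ) • x)) (mem_univ ((r : ℝ) • y))
        (by positivity : 0 ≤ (r : ℝ) / (s + r)) (by positivity : 0 ≤ (s : ℝ) / (s + r))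
        (by field_simp; ring)
      have h0 : ((r : ℝ) / (s + r)) • ((s : ℝ) • x) + ((s : ℝ) / (s + r)) • ((r : ℝ) • y)
          = ((s * r : ℝ) / (s + r)) • (x + y) := by
        rw [smul_smul, smul_smul, smul_add]; congr 2 <;> ring
      rw [h0] at h
      refine (hNle (x + y) (s * r / (s + r)) (by positivity)).trans ?_
      rw [div_le_iff₀ (by positivity)]
      refine h.trans (le_of_eq ?_)
      simp only [smul_eq_mul]
      field_simp)
    (fun x => by
      refine le_ciInf fun t => ?_
      have ht : (0 : ℝ) < t := t.2
      have h := hf ((t : ℝ) • x)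
      rw [f.map_smul, smul_eq_mul] at h
      rw [le_div_iff₀ ht, mul_comm]
      exact h)
  exact ⟨g, hg, fun x => (hgN x).trans (by simpa using hNle x 1 one_pos)⟩

/-! ### The `L¹` norm on `L²` and its subgradients. -/

namespace L2Space

variable {Ω F : Type*} [MeasurableSpace Ω] {μ : Measure Ω}
  [NormedAddCommGroup F]

/-- The `L¹` norm on `L²`. -/
noncomputable def l1norm (w : Lp F 2 μ) : ℝ := ∫ t, ‖w t‖ ∂μ

theorem l1norm_nonneg (w : Lp F 2 μ) : 0 ≤ l1norm w := integral_nonneg fun _ => norm_nonneg _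

theorem l1norm_smul [NormedSpace ℝ F] (c : ℝ) (w : Lp F 2 μ) :
    l1norm (c • w) = |c| * l1norm w := by
  unfold l1norm
  rw [← integral_const_mul]
  refine integral_congr_ae ?_
  filter_upwards [Lp.coeFn_smul c w] with t ht
  rw [ht, Pi.smul_apply, norm_smul, Real.norm_eq_abs]

variable [IsFiniteMeasure μ]

theorem integrable_norm (w : Lp F 2 μ) : Integrable (fun t => ‖w t‖) μ :=
  ((Lp.memLp w).integrable (by norm_num)).norm

theorem l1norm_add_le (v w : Lp F 2 μ) : l1norm (v + w) ≤ l1norm v + l1norm w := by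
  unfold l1norm
  rw [← integral_add (integrable_norm v) (integrable_norm w)]
  refine integral_mono_ae (integrable_norm _) ((integrable_norm v).add (integrable_norm w)) ?_
  filter_upwards [Lp.coeFn_add v w] with t ht
  rw [ht]
  exact norm_add_le _ _

theorem l1norm_le (w : Lp F 2 μ) : l1norm w ≤ (μ.real univ) ^ (1 / 2 : ℝ) * ‖w‖ := by
  have h := eLpNorm_le_eLpNorm_mul_rpow_measure_univ (p := 1) (q := 2) (by norm_num)
    (Lp.memLp w).aestronglyMeasurable
  have h2 := ENNReal.toReal_mono (ENNReal.mul_ne_top (Lp.memLp w).2.ne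
    (ENNReal.rpow_ne_top_of_nonneg (by norm_num) (measure_ne_top μ univ))) h
  rw [ENNReal.toReal_mul, ← Lp.norm_def, eLpNorm_one_eq_lintegral_enorm,
    ← integral_norm_eq_lintegral_enorm (Lp.memLp w).aestronglyMeasurable,
    ← ENNReal.toReal_rpow, mul_comm] at h2
  refine h2.trans (le_of_eq ?_)
  congr 2
  norm_num

theorem abs_l1norm_sub_le (v w : Lp F 2 μ) : |l1norm v - l1norm w| ≤ l1norm (v - w) := by
  have h1 := l1norm_add_le (v - w) w
  have h2 := l1norm_add_le (w - v) v
  have h3 : l1norm (w - v) = l1norm (v - w) := by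
    refine integral_congr_ae ?_
    filter_upwards [Lp.coeFn_sub v w, Lp.coeFn_sub w v] with t h h'
    rw [h, h', Pi.sub_apply, Pi.sub_apply, norm_sub_rev]
  rw [sub_add_cancel] at h1 h2
  rw [abs_le]
  constructor <;> linarith

theorem continuous_l1norm : Continuous (l1norm : Lp F 2 μ → ℝ) := by
  refine LipschitzWith.continuous (K := ⟨(μ.real univ) ^ (1 / 2 : ℝ), by positivity⟩)
    (LipschitzWith.of_dist_le_mul fun v w => ?_)
  rw [Real.dist_eq, dist_eq_norm]
  exact (abs_l1norm_sub_le v w).trans (l1norm_le _)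

variable [InnerProductSpace ℝ F]

theorem convexOn_l1norm : ConvexOn ℝ univ (l1norm : Lp F 2 μ → ℝ) := by
  refine ⟨convex_univ, fun x _ y _ a b ha hb _ => ?_⟩
  have := l1norm_add_le (a • x) (b • y)
  rwa [l1norm_smul, l1norm_smul, abs_of_nonneg ha, abs_of_nonneg hb] at this

/-- A linear functional on `L²` dominated by `w ↦ ‖u + w‖₁ - ‖u‖₁` is represented by a field of
subgradients of the norm along `u`. -/
theorem exists_subgradient [CompleteSpace F] (u : Lp F 2 μ) (g : Lp F 2 μ →ₗ[ℝ] ℝ)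
    (hg : ∀ w, g w ≤ l1norm (u + w) - l1norm u) :
    ∃ lam : Lp F ⊤ μ, (∀ w : Lp F 2 μ, g w = ∫ t, inner ℝ (lam t) (w t) ∂μ) ∧
      ∀ᵐ t ∂μ, ‖lam t‖ ≤ 1 ∧ ∀ ν : F, ‖ν‖ ≤ 1 → inner ℝ (ν - lam t) (u t) ≤ 0 := by
  have hg1 : ∀ w, g w ≤ l1norm w := fun w => by
    linarith [hg w, l1norm_add_le u w]
  have hgc : ∀ w, ‖g w‖ ≤ (μ.real univ) ^ (1 / 2 : ℝ) * ‖w‖ := by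
    intro w
    have h1 := (hg1 w).trans (l1norm_le w)
    have h2 := (hg1 (-w)).trans (l1norm_le (-w))
    rw [map_neg, norm_neg] at h2
    rw [Real.norm_eq_abs, abs_le]
    constructor <;> linarith
  let G : Lp F 2 μ →L[ℝ] ℝ := g.mkContinuous _ hgc
  let l : Lp F 2 μ := (InnerProductSpace.toDual ℝ (Lp F 2 μ)).symm G
  have hl : ∀ w, inner ℝ l w = g w := fun w => by
    simp only [l, InnerProductSpace.toDual_symm_apply]; rfl
  have hlm : AEStronglyMeasurable l μ := (Lp.memLp l).aestronglyMeasurable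
  -- Testing `g` on `l` cut off to `{‖l‖ > 1}` gives `∫ ‖l‖² ≤ ∫ ‖l‖` over that set, which must then
  -- be null. The representative `l'` serves to make the set measurable.
  have hl1 : ∀ᵐ t ∂μ, ‖l t‖ ≤ 1 := by
    obtain ⟨l', hl'm, hl'⟩ := hlm
    let s : Set Ω := {t | 1 < ‖l' t‖}
    have hs : MeasurableSet s := measurableSet_lt measurable_const hl'm.norm.measurable
    have hmem : MemLp (s.indicator l) 2 μ := (Lp.memLp l).indicator hs
    have h1 := hg1 (hmem.toLp _)
    rw [← hl, L2.inner_def, l1norm] at h1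
    have hi : Integrable (fun t => ‖s.indicator l t‖ * (‖s.indicator l t‖ - 1)) μ := by
      have h2 : Integrable (fun t => ‖s.indicator l t‖ ^ 2) μ := hmem.integrable_norm_pow (by norm_num)
      have h3 : Integrable (fun t => ‖s.indicator l t‖) μ := (hmem.integrable (by norm_num)).norm
      refine (h2.sub h3).congr (Eventually.of_forall fun t => ?_)
      simp only [Pi.sub_apply]; ring
    have h0 : ∫ t, ‖s.indicator l t‖ * (‖s.indicator l t‖ - 1) ∂μ ≤ 0 := by
      have h3 : Integrable (fun t => ‖s.indicator l t‖) μ := (hmem.integrable (by norm_num)).norm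
      have e1 : ∫ t, inner ℝ (l t) (hmem.toLp _ t) ∂μ
          = ∫ t, (‖s.indicator l t‖ * (‖s.indicator l t‖ - 1) + ‖s.indicator l t‖) ∂μ := by
        refine integral_congr_ae ?_
        filter_upwards [hmem.coeFn_toLp] with t ht
        rw [ht]
        by_cases hts : t ∈ s
        · simp only [indicator_of_mem hts, real_inner_self_eq_norm_sq]; ring
        · simp [indicator_of_notMem hts]
      have e2 : ∫ t, ‖hmem.toLp _ t‖ ∂μ = ∫ t, ‖s.indicator l t‖ ∂μ := by
        refine integral_congr_ae ?_
        filter_upwards [hmem.coeFn_toLp] with t ht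
        rw [ht]
      rw [e1, e2, integral_add hi h3] at h1
      linarith
    have hnn : 0 ≤ᵐ[μ] fun t => ‖s.indicator l t‖ * (‖s.indicator l t‖ - 1) := by
      filter_upwards [hl'] with t ht
      by_cases hts : t ∈ s
      · have : 1 < ‖l t‖ := by rw [ht]; exact hts
        simp only [indicator_of_mem hts, Pi.zero_apply]
        nlinarith
      · simp [indicator_of_notMem hts]
    have hz := (integral_eq_zero_iff_of_nonneg_ae hnn hi).1
      (le_antisymm h0 (integral_nonneg_of_ae hnn))
    filter_upwards [hz, hl'] with t ht ht'
    by_contra hcon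
    push Not at hcon
    have hts : t ∈ s := by change 1 < ‖l' t‖; rwa [← ht']
    simp only [indicator_of_mem hts, Pi.zero_apply] at ht
    nlinarith
  have hmemtop : MemLp l ⊤ μ := memLp_top_of_bound hlm 1 hl1
  refine ⟨hmemtop.toLp _, fun w => ?_, ?_⟩
  · rw [← hl, L2.inner_def]
    refine integral_congr_ae ?_
    filter_upwards [hmemtop.coeFn_toLp] with t ht
    rw [ht]
  · have hi1 := L2.integrable_inner (𝕜 := ℝ) l u
    -- The direction `-u` reaches the origin, where the `L¹` norm is zero. With `‖l‖ ≤ 1` this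
    -- forces `(l, u) = ‖u‖` a.e., which is the subgradient condition.
    have h1 : l1norm u ≤ ∫ t, inner ℝ (l t) (u t) ∂μ := by
      have := hg (-u)
      have h0 : l1norm (u + -u) = 0 := by
        rw [add_neg_cancel, ← zero_smul ℝ u, l1norm_smul]; simp
      rw [h0, map_neg, ← hl, L2.inner_def] at this
      linarith
    have hnn : 0 ≤ᵐ[μ] fun t => ‖u t‖ - inner ℝ (l t) (u t) := by
      filter_upwards [hl1] with t ht
      have := real_inner_le_norm (l t) (u t)
      have h2 : ‖l t‖ * ‖u t‖ ≤ 1 * ‖u t‖ := by gcongr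
      simp only [Pi.zero_apply]
      linarith
    have hz := (integral_eq_zero_iff_of_nonneg_ae hnn ((integrable_norm u).sub hi1)).1 (by
      refine le_antisymm ?_ (integral_nonneg_of_ae hnn)
      rw [integral_sub (integrable_norm u) hi1]
      unfold l1norm at h1
      linarith)
    filter_upwards [hz, hl1, hmemtop.coeFn_toLp] with t ht ht1 ht2
    rw [ht2]
    refine ⟨ht1, fun ν hν => ?_⟩
    simp only [Pi.zero_apply] at ht
    have := real_inner_le_norm ν (u t)
    have h2 : ‖ν‖ * ‖u t‖ ≤ 1 * ‖u t‖ := by gcongr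
    rw [inner_sub_left]
    linarith

end L2Space

/-! ### The space `H¹₀` and Poincaré's inequality. -/

section Sobolev

variable {T : ℝ} {n : ℕ}

/-- The inclusion of `H¹₀` in `L²`. -/
noncomputable def H10.valL (T : ℝ) (n : ℕ) : H10 T n →L[ℝ] L2 T n :=
  (WithLp.fstL 2 ℝ (L2 T n) (L2 T n)).comp (H10 T n).subtypeL

/-- The weak derivative as a continuous linear map. -/
noncomputable def H10.derivL (T : ℝ) (n : ℕ) : H10 T n →L[ℝ] L2 T n :=
  (WithLp.sndL 2 ℝ (L2 T n) (L2 T n)).comp (H10 T n).subtypeL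

theorem H10.valL_apply (u : H10 T n) : H10.valL T n u = H10val u := rfl

theorem H10.derivL_apply (u : H10 T n) : H10.derivL T n u = H10deriv u := rfl

instance : CompleteSpace (H10 T n) :=
  (Submodule.isClosed_topologicalClosure _).completeSpace_coe

/-- Test functions are stable under linear combinations. Hence `H10` is the closure of actual test
pairs, and a closed condition need only be checked on these. -/
theorem span_testPairs (T : ℝ) (n : ℕ) :
    (Submodule.span ℝ (testPairs T n) : Set (WithLp 2 (L2 T n × L2 T n))) = testPairs T n := by
  refine Subset.antisymm (fun w hw => ?_) Submodule.subset_span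
  induction hw using Submodule.span_induction with
  | mem x hx => exact hx
  | zero =>
    refine ⟨0, contDiff_const, HasCompactSupport.zero, by simp [tsupport], ?_, ?_⟩
    · exact Lp.coeFn_zero _ _ _
    · have h : deriv (0 : ℝ → Vec n) = 0 := by ext1 t; exact deriv_const t (0 : Vec n)
      rw [h]
      exact Lp.coeFn_zero _ _ _
  | add x y _ _ hx hy =>
    obtain ⟨φ, h1, h2, h3, h4, h5⟩ := hx
    obtain ⟨ψ, k1, k2, k3, k4, k5⟩ := hy
    refine ⟨φ + ψ, h1.add k1, h2.add k2,
      (tsupport_add φ ψ).trans (union_subset h3 k3), ?_, ?_⟩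
    · exact (Lp.coeFn_add x.fst y.fst).trans (h4.add k4)
    · have h : deriv (φ + ψ) = deriv φ + deriv ψ := by
        ext1 t
        exact deriv_add (h1.differentiable (by simp) t) (k1.differentiable (by simp) t)
      rw [h]
      exact (Lp.coeFn_add x.snd y.snd).trans (h5.add k5)
  | smul a x _ hx =>
    obtain ⟨φ, h1, h2, h3, h4, h5⟩ := hx
    refine ⟨a • φ, h1.const_smul a, h2.smul_left (f := fun _ => a),
      (closure_mono (Function.support_const_smul_subset a φ)).trans h3, ?_, ?_⟩
    · exact (Lp.coeFn_smul a x.fst).trans (h4.const_smul a)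
    · have h : deriv (a • φ) = a • deriv φ := by
        ext1 t
        exact deriv_const_smul a (h1.differentiable (by simp) t)
      rw [h]
      exact (Lp.coeFn_smul a x.snd).trans (h5.const_smul a)

/-- Poincaré's inequality for test functions. -/
theorem testPairs_poincare {w : WithLp 2 (L2 T n × L2 T n)} (hw : w ∈ testPairs T n) :
    ‖w.fst‖ ≤ (timeMeasure T).real univ ^ (1 / 2 : ℝ)
      * ((timeMeasure T).real univ ^ (1 / 2 : ℝ) * ‖w.snd‖) := by
  obtain ⟨φ, h1, -, h3, h4, h5⟩ := hw
  have h0 : φ 0 = 0 := image_eq_zero_of_notMem_tsupport fun h => (h3 h).1.ne rfl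
  -- Since `φ 0 = 0`, the value `φ t` is the integral of `φ'`. Each of the passages `L² → L¹` for
  -- `φ'` and `L^∞ → L²` for `φ` costs a factor `|]0,T[|^(1/2)`.
  have hbound : ∀ t ∈ Ioo 0 T, ‖φ t‖ ≤ L2Space.l1norm w.snd := by
    intro t ht
    have hd : Continuous (deriv φ) := h1.continuous_deriv (by simp)
    have h6 : ∫ s in (0 : ℝ)..t, deriv φ s = φ t - φ 0 :=
      intervalIntegral.integral_deriv_eq_sub (fun s _ => h1.differentiable (by simp) s)
        (hd.intervalIntegrable _ _)
    rw [h0, sub_zero] at h6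
    have h7 : L2Space.l1norm w.snd = ∫ s in Ioo 0 T, ‖deriv φ s‖ := by
      refine integral_congr_ae ?_
      filter_upwards [h5] with s hs
      rw [hs]
    rw [h7, ← h6]
    refine (intervalIntegral.norm_integral_le_integral_norm ht.1.le).trans ?_
    rw [intervalIntegral.integral_of_le ht.1.le]
    refine setIntegral_mono_set ?_ (Eventually.of_forall fun _ => norm_nonneg _) ?_
    · exact (hd.norm.integrableOn_Icc (a := 0) (b := T)).mono_set Ioo_subset_Icc_self
    · exact Eventually.of_forall fun s hs => ⟨hs.1, hs.2.trans_lt ht.2⟩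
  have h8 : ∀ᵐ t ∂(timeMeasure T), ‖w.fst t‖ ≤ L2Space.l1norm w.snd := by
    filter_upwards [h4, ae_restrict_mem measurableSet_Ioo] with t ht ht2
    rw [ht]
    exact hbound t ht2
  have h9 := Lp.norm_le_of_ae_bound (L2Space.l1norm_nonneg w.snd) h8
  have e : ((2 : ENNReal).toReal)⁻¹ = (1 / 2 : ℝ) := by norm_num
  rw [e] at h9
  exact h9.trans (mul_le_mul_of_nonneg_left (L2Space.l1norm_le w.snd) (by positivity))

/-- Poincaré's inequality in `H¹₀`. -/
theorem exists_poincare (T : ℝ) (n : ℕ) :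
    ∃ c : ℝ, 0 < c ∧ ∀ u : H10 T n, c * ‖u‖ ^ 2 ≤ ‖H10deriv u‖ ^ 2 := by
  set C : ℝ := (timeMeasure T).real univ ^ (1 / 2 : ℝ) * (timeMeasure T).real univ ^ (1 / 2 : ℝ)
    with hC
  have hC0 : 0 ≤ C := by positivity
  have hmem : ∀ u : H10 T n, ‖H10val u‖ ≤ C * ‖H10deriv u‖ := by
    intro u
    have hcl : IsClosed {w : WithLp 2 (L2 T n × L2 T n) | ‖w.fst‖ ≤ C * ‖w.snd‖} :=
      isClosed_le ((WithLp.fstL 2 ℝ (L2 T n) (L2 T n)).continuous.norm)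
        (continuous_const.mul (WithLp.sndL 2 ℝ (L2 T n) (L2 T n)).continuous.norm)
    have hsub : closure (Submodule.span ℝ (testPairs T n) : Set (WithLp 2 (L2 T n × L2 T n)))
        ⊆ {w | ‖w.fst‖ ≤ C * ‖w.snd‖} := by
      refine closure_minimal (fun w hw => ?_) hcl
      rw [span_testPairs] at hw
      have := testPairs_poincare hw
      rw [← mul_assoc] at this
      exact this
    exact hsub u.2
  refine ⟨1 / (C ^ 2 + 1), by positivity, fun u => ?_⟩
  have h1 : ‖u‖ ^ 2 = ‖H10val u‖ ^ 2 + ‖H10deriv u‖ ^ 2 :=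
    WithLp.prod_norm_sq_eq_of_L2 (u : WithLp 2 (L2 T n × L2 T n))
  rw [one_div_mul_eq_div, div_le_iff₀ (by positivity), h1]
  have := pow_le_pow_left₀ (norm_nonneg _) (hmem u) 2
  rw [mul_pow] at this
  linarith

end Sobolev

/-! ### The cost: coercivity, multipliers and quadratic growth. -/

/-- The norm is attained by the subgradient. -/
theorem norm_le_inner_of_forall_ball {F : Type*} [NormedAddCommGroup F] [InnerProductSpace ℝ F]
    {l x : F} (h : ∀ ν : F, ‖ν‖ ≤ 1 → inner ℝ (ν - l) x ≤ 0) : ‖x‖ ≤ inner ℝ l x := by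
  rcases eq_or_ne x 0 with rfl | hx
  · simp
  have hx' : ‖x‖ ≠ 0 := norm_ne_zero_iff.2 hx
  have := h (‖x‖⁻¹ • x) (by rw [norm_smul, norm_inv, norm_norm, inv_mul_cancel₀ hx'])
  rw [inner_sub_left, real_inner_smul_left, real_inner_self_eq_norm_sq] at this
  have e : ‖x‖⁻¹ * ‖x‖ ^ 2 = ‖x‖ := by field_simp
  linarith

namespace ControlSystem

variable {N p : ℕ} (S : ControlSystem N p)

/-- The bilinear form `∫ α (u,v) + β (u',v')`. -/
noncomputable def energy (α β : ℝ) (u v : S.Control) : ℝ :=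
  α * inner ℝ (H10val u) (H10val v) + β * inner ℝ (H10deriv u) (H10deriv v)

variable {S} {α β γ : ℝ}

theorem energy_add_right (u v w : S.Control) :
    S.energy α β u (v + w) = S.energy α β u v + S.energy α β u w := by
  simp only [energy, ← H10.valL_apply, ← H10.derivL_apply, map_add, inner_add_right]
  ring

theorem energy_smul_right (c : ℝ) (u v : S.Control) :
    S.energy α β u (c • v) = c * S.energy α β u v := by
  simp only [energy, ← H10.valL_apply, ← H10.derivL_apply, map_smul, real_inner_smul_right]
  ring

theorem energy_comm (u v : S.Control) : S.energy α β u v = S.energy α β v u := by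
  simp only [energy, real_inner_comm]

theorem energy_add_left (u v w : S.Control) :
    S.energy α β (u + v) w = S.energy α β u w + S.energy α β v w := by
  rw [energy_comm, energy_add_right, energy_comm w u, energy_comm w v]

theorem energy_smul_left (c : ℝ) (u v : S.Control) :
    S.energy α β (c • u) v = c * S.energy α β u v := by
  rw [energy_comm, energy_smul_right, energy_comm]

theorem energy_self (u : S.Control) :
    S.energy α β u u = α * ‖H10val u‖ ^ 2 + β * ‖H10deriv u‖ ^ 2 := by
  simp only [energy, real_inner_self_eq_norm_sq]

theorem continuous_energy_self : Continuous fun u : S.Control => S.energy α β u u := by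
  simp only [energy_self, ← H10.valL_apply, ← H10.derivL_apply]
  fun_prop

theorem le_energy_self (hα : 0 ≤ α) (u : S.Control) :
    β * ‖H10deriv u‖ ^ 2 ≤ S.energy α β u u := by
  rw [energy_self]
  have : 0 ≤ α * ‖H10val u‖ ^ 2 := by positivity
  linarith

theorem exists_energy_coercive (S : ControlSystem N p) (hα : 0 ≤ α) (hβ : 0 < β) :
    ∃ c : ℝ, 0 < c ∧ ∀ u : S.Control, c * ‖u‖ ^ 2 ≤ S.energy α β u u := by
  obtain ⟨c, hc, h⟩ := exists_poincare S.T p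
  refine ⟨β * c, by positivity, fun u => (le_trans ?_ (le_energy_self hα u))⟩
  rw [mul_assoc]
  exact mul_le_mul_of_nonneg_left (h u) hβ.le

theorem cost_eq (v : S.Control) :
    S.cost α β γ v = S.energy α β v v + 2 * γ * L2Space.l1norm (H10deriv v) := by
  have h1 := L2.integrable_inner (𝕜 := ℝ) (H10val v) (H10val v)
  have h2 := L2.integrable_inner (𝕜 := ℝ) (H10deriv v) (H10deriv v)
  have h3 := L2Space.integrable_norm (H10deriv v)
  rw [energy, L2.inner_def, L2.inner_def, L2Space.l1norm, ← integral_const_mul,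
    ← integral_const_mul, ← integral_const_mul,
    ← integral_add (h1.const_mul α) (h2.const_mul β),
    cost]
  refine Eq.trans (integral_congr_ae (Eventually.of_forall fun t => ?_))
    (integral_add ((h1.const_mul α).add (h2.const_mul β)) (h3.const_mul (2 * γ)))
  simp only [real_inner_self_eq_norm_sq]

theorem continuous_cost : Continuous fun v : S.Control => S.cost α β γ v := by
  simp only [cost_eq]
  exact continuous_energy_self.add (continuous_const.mul
    (L2Space.continuous_l1norm.comp (H10.derivL S.T p).continuous))

theorem cost_nonneg (hα : 0 ≤ α) (hβ : 0 ≤ β) (hγ : 0 ≤ γ) (v : S.Control) :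
    0 ≤ S.cost α β γ v := by
  rw [cost_eq, energy_self]
  have := L2Space.l1norm_nonneg (H10deriv v)
  positivity

/-- The parallelogram identity for the quadratic part produces the gain `energy / 4`; the `L¹` part
is only convex. -/
theorem cost_midpoint_le (hγ : 0 ≤ γ) (x y : S.Control) :
    S.cost α β γ ((1 / 2 : ℝ) • x + (1 / 2 : ℝ) • y)
      ≤ (S.cost α β γ x + S.cost α β γ y) / 2 - S.energy α β (x - y) (x - y) / 4 := by
  have h1 : S.energy α β ((1 / 2 : ℝ) • x + (1 / 2 : ℝ) • y) ((1 / 2 : ℝ) • x + (1 / 2 : ℝ) • y)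
      = (S.energy α β x x + S.energy α β y y) / 2 - S.energy α β (x - y) (x - y) / 4 := by
    rw [sub_eq_add_neg x y, ← neg_one_smul ℝ y]
    simp only [energy_add_left, energy_add_right, energy_smul_left, energy_smul_right,
      energy_comm y x]
    ring
  have h2 := (L2Space.convexOn_l1norm (μ := timeMeasure S.T)).2 (mem_univ (H10deriv x))
    (mem_univ (H10deriv y)) (by norm_num : (0 : ℝ) ≤ 1 / 2) (by norm_num : (0 : ℝ) ≤ 1 / 2)
    (by norm_num)
  have h3 : H10deriv ((1 / 2 : ℝ) • x + (1 / 2 : ℝ) • y)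
      = (1 / 2 : ℝ) • H10deriv x + (1 / 2 : ℝ) • H10deriv y := rfl
  rw [cost_eq, cost_eq, cost_eq, h1, h3]
  have h4 := mul_le_mul_of_nonneg_left h2 (by positivity : 0 ≤ 2 * γ)
  simp only [smul_eq_mul] at h4
  linarith

/-- Lagrange multipliers: a minimizer of `½ c - ℓ` over `u + W` satisfies the Euler equation along
`W` with a subgradient field `lam` of the norm. -/
theorem exists_multiplier (hγ : 0 < γ)
    (W : Submodule ℝ S.Control) (l : S.Control →ₗ[ℝ] ℝ) (u : S.Control)
    (hmin : ∀ w ∈ W, S.cost α β γ u / 2 - l u ≤ S.cost α β γ (u + w) / 2 - l (u + w)) :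
    ∃ lam : Lp (Vec p) ⊤ (timeMeasure S.T),
      (∀ w ∈ W, S.energy α β u w + γ * ∫ t, inner ℝ (lam t) (H10deriv w t) ∂(timeMeasure S.T)
        = l w) ∧
      ∀ᵐ t ∂(timeMeasure S.T), ‖lam t‖ ≤ 1 ∧
        ∀ μ : Vec p, ‖μ‖ ≤ 1 → inner ℝ (μ - lam t) (H10deriv u t) ≤ 0 := by
  obtain ⟨c, hc, hcoer⟩ := exists_poincare S.T p
  let E : S.Control →ₗ[ℝ] ℝ :=
    { toFun := fun w => S.energy α β u w
      map_add' := energy_add_right u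
      map_smul' := fun a w => energy_smul_right a u w }
  -- `R` is the Euler residual that the subgradient must represent, and `q` the increment of the
  -- `L¹` norm at `u'` that dominates it on `W`.
  let R : S.Control →ₗ[ℝ] ℝ := γ⁻¹ • (l - E)
  let q : L2 S.T p → ℝ := fun w => L2Space.l1norm (H10deriv u + w) - L2Space.l1norm (H10deriv u)
  have hq : ConvexOn ℝ univ q := by
    refine ⟨convex_univ, fun x _ y _ a b ha hb hab => ?_⟩
    have h := (L2Space.convexOn_l1norm (μ := timeMeasure S.T)).2 (mem_univ (H10deriv u + x))
      (mem_univ (H10deriv u + y)) ha hb hab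
    have e : a • (H10deriv u + x) + b • (H10deriv u + y) = H10deriv u + (a • x + b • y) := by
      rw [smul_add, smul_add, add_add_add_comm, ← add_smul, hab, one_smul]
    rw [e] at h
    simp only [smul_eq_mul, q] at h ⊢
    linear_combination h + (hab) * L2Space.l1norm (H10deriv u)
  have hR : ∀ w ∈ W, R w ≤ q (H10deriv w) := by
    intro w hw
    -- Minimality is used at `u + t • w`. Convexity makes the nonsmooth increment at most `t * q
    -- (H10deriv w)`, so after division by `t` only the quadratic remainder, of order `t`, survives.
    have key : ∀ t : ℝ, 0 < t → t ≤ 1 →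
        l w - S.energy α β u w - γ * q (H10deriv w) ≤ t * (S.energy α β w w / 2) := by
      intro t ht ht1
      have h1 := hmin _ (W.smul_mem t hw)
      rw [cost_eq, cost_eq] at h1
      have h2 : q (H10deriv (t • w)) ≤ t * q (H10deriv w) := by
        have h := hq.2 (mem_univ (H10deriv w)) (mem_univ 0) ht.le (sub_nonneg.2 ht1)
          (by ring)
        rw [smul_zero, add_zero] at h
        have h0 : q 0 = 0 := by simp [q]
        rwa [h0, smul_zero, add_zero] at h
      have h3 : L2Space.l1norm (H10deriv (u + t • w))
          = q (H10deriv (t • w)) + L2Space.l1norm (H10deriv u) := by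
        simp only [q, ← H10.derivL_apply, map_add]
        ring
      rw [h3] at h1
      simp only [energy_add_left, energy_add_right, energy_smul_left, energy_smul_right,
        map_add, map_smul, smul_eq_mul, energy_comm w u] at h1
      have h4 := mul_le_mul_of_nonneg_left h2 hγ.le
      have h5 : t * (l w - S.energy α β u w - γ * q (H10deriv w))
          ≤ t * (t * (S.energy α β w w / 2)) := by nlinarith
      exact le_of_mul_le_mul_left h5 ht
    have hlim : Tendsto (fun t : ℝ => t * (S.energy α β w w / 2)) (𝓝[>] 0) (𝓝 0) := by
      have : Continuous fun t : ℝ => t * (S.energy α β w w / 2) := by fun_prop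
      simpa using (this.tendsto 0).mono_left nhdsWithin_le_nhds
    have h6 : l w - S.energy α β u w - γ * q (H10deriv w) ≤ 0 := by
      refine ge_of_tendsto hlim ?_
      filter_upwards [Ioc_mem_nhdsGT (zero_lt_one (α := ℝ))] with t ht
      exact key t ht.1 ht.2
    change γ⁻¹ * (l w - S.energy α β u w) ≤ _
    rw [inv_mul_le_iff₀ hγ]
    linarith
  -- By Poincaré's inequality a control is determined by its derivative, so `R` becomes a functional
  -- on a subspace of `L²` even though it also involves `u` itself.
  let j : W →ₗ[ℝ] L2 S.T p := (H10.derivL S.T p).toLinearMap.comp W.subtype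
  have hj : Function.Injective j := by
    rw [injective_iff_map_eq_zero]
    intro w hw
    have h1 := hcoer (w : S.Control)
    have h2 : H10deriv (w : S.Control) = 0 := hw
    rw [h2, norm_zero] at h1
    have h3 : ‖(w : S.Control)‖ ^ 2 ≤ 0 := by
      by_contra h
      push Not at h
      have := mul_pos hc h
      linarith
    have h4 : (w : S.Control) = 0 := by
      rw [← norm_eq_zero]
      exact pow_eq_zero_iff two_ne_zero |>.1 (le_antisymm h3 (by positivity))
    exact Subtype.ext h4
  let e := LinearEquiv.ofInjective j hj
  let f : L2 S.T p →ₗ.[ℝ] ℝ := ⟨LinearMap.range j, (R.comp W.subtype).comp e.symm.toLinearMap⟩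
  have hf : ∀ w : W, f (e w) = R w := fun w => by
    change R ((e.symm (e w) : W) : S.Control) = R w
    rw [e.symm_apply_apply]
  obtain ⟨g, hg, hgq⟩ := exists_extension_of_le_convex f q (by simp [q]) hq (by
    intro x
    obtain ⟨w, rfl⟩ := e.surjective x
    rw [hf]
    exact hR w w.2)
  obtain ⟨lam, hlam, hae⟩ := L2Space.exists_subgradient (H10deriv u) g hgq
  refine ⟨lam, fun w hw => ?_, hae⟩
  have h1 : g (H10deriv w) = R w := (hg (e ⟨w, hw⟩)).trans (hf ⟨w, hw⟩)
  rw [← hlam, h1]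
  change S.energy α β u w + γ * (γ⁻¹ * (l w - S.energy α β u w)) = l w
  field_simp
  ring

theorem integrable_inner_of_bound {T : ℝ} {n : ℕ} {lam : Lp (Vec n) ⊤ (timeMeasure T)}
    (h : ∀ᵐ t ∂(timeMeasure T), ‖lam t‖ ≤ 1) (w : L2 T n) :
    Integrable (fun t => inner ℝ (lam t) (w t)) (timeMeasure T) := by
  refine (L2Space.integrable_norm w).mono' ?_ ?_
  · exact (Lp.memLp lam).aestronglyMeasurable.inner (Lp.memLp w).aestronglyMeasurable
  · filter_upwards [h] with t ht
    refine (norm_inner_le_norm _ _).trans ?_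
    exact mul_le_of_le_one_left (norm_nonneg _) ht

theorem integral_mixed_eq (u v : S.Control) {lam : Lp (Vec p) ⊤ (timeMeasure S.T)}
    (h : ∀ᵐ t ∂(timeMeasure S.T), ‖lam t‖ ≤ 1) :
    ∫ t, (α * inner ℝ (H10val u t) (H10val v t) + β * inner ℝ (H10deriv u t) (H10deriv v t)
      + γ * inner ℝ (lam t) (H10deriv v t)) ∂(timeMeasure S.T)
      = S.energy α β u v + γ * ∫ t, inner ℝ (lam t) (H10deriv v t) ∂(timeMeasure S.T) := by
  have h1 := L2.integrable_inner (𝕜 := ℝ) (H10val u) (H10val v)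
  have h2 := L2.integrable_inner (𝕜 := ℝ) (H10deriv u) (H10deriv v)
  rw [energy, L2.inner_def, L2.inner_def, ← integral_const_mul, ← integral_const_mul,
    ← integral_const_mul, ← integral_add (h1.const_mul α) (h2.const_mul β)]
  exact integral_add ((h1.const_mul α).add (h2.const_mul β))
    ((integrable_inner_of_bound h _).const_mul γ)

/-- Quadratic growth of `½ c - ℓ` at a solution of its Euler equation. -/
theorem half_cost_growth (hγ : 0 ≤ γ)
    (l : S.Control →ₗ[ℝ] ℝ) {u : S.Control} {lam : Lp (Vec p) ⊤ (timeMeasure S.T)}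
    (h1 : ∀ w, S.energy α β u w + γ * ∫ t, inner ℝ (lam t) (H10deriv w t) ∂(timeMeasure S.T) = l w)
    (h2 : ∀ᵐ t ∂(timeMeasure S.T), ‖lam t‖ ≤ 1 ∧
        ∀ μ : Vec p, ‖μ‖ ≤ 1 → inner ℝ (μ - lam t) (H10deriv u t) ≤ 0) (v : S.Control) :
    S.cost α β γ u / 2 - l u + S.energy α β (v - u) (v - u) / 2
      ≤ S.cost α β γ v / 2 - l v := by
  have hb : ∀ᵐ t ∂(timeMeasure S.T), ‖lam t‖ ≤ 1 := h2.mono fun t ht => ht.1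
  -- The pairing with `lam` lies below the `L¹` norm and touches it at `u'`; the growth then comes
  -- from the quadratic part alone.
  have hv : ∫ t, inner ℝ (lam t) (H10deriv v t) ∂(timeMeasure S.T)
      ≤ L2Space.l1norm (H10deriv v) := by
    refine integral_mono_ae (integrable_inner_of_bound hb _) (L2Space.integrable_norm _) ?_
    filter_upwards [hb] with t ht
    exact (real_inner_le_norm _ _).trans (mul_le_of_le_one_left (norm_nonneg _) ht)
  have hu : L2Space.l1norm (H10deriv u)
      ≤ ∫ t, inner ℝ (lam t) (H10deriv u t) ∂(timeMeasure S.T) := by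
    refine integral_mono_ae (L2Space.integrable_norm _) (integrable_inner_of_bound hb _) ?_
    filter_upwards [h2] with t ht
    exact norm_le_inner_of_forall_ball ht.2
  have e1 : S.energy α β (v - u) (v - u)
      = S.energy α β v v - 2 * S.energy α β u v + S.energy α β u u := by
    rw [sub_eq_add_neg v u, ← neg_one_smul ℝ u]
    simp only [energy_add_left, energy_add_right, energy_smul_left, energy_smul_right,
      energy_comm v u]
    ring
  rw [cost_eq, cost_eq, e1, ← h1 u, ← h1 v]
  have h3 := mul_le_mul_of_nonneg_left hv hγ
  have h4 := mul_le_mul_of_nonneg_left hu hγ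
  linarith

theorem eq_of_energy_sub_nonpos (hα : 0 ≤ α) (hβ : 0 < β) {u v : S.Control}
    (h : S.energy α β (u - v) (u - v) ≤ 0) : u = v := by
  obtain ⟨c, hc, hcoer⟩ := exists_energy_coercive S hα hβ
  have h3 : ‖u - v‖ ^ 2 ≤ 0 := by
    by_contra h'
    push Not at h'
    have := mul_pos hc h'
    linarith [hcoer (u - v)]
  rw [← sub_eq_zero, ← norm_eq_zero]
  exact pow_eq_zero_iff two_ne_zero |>.1 (le_antisymm h3 (by positivity))

/-- Serves twice: over all controls it produces `u(Ψ)`, and over the exact controls with `l = 0` the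
control of minimal cost. -/
theorem exists_minimizer_half_cost_sub (hα : 0 ≤ α) (hβ : 0 < β) (hγ : 0 ≤ γ)
    (l : S.Control →L[ℝ] ℝ) {A : Set S.Control} (hA : IsClosed A) (hAc : Convex ℝ A)
    (hne : A.Nonempty) :
    ∃ u ∈ A, ∀ v ∈ A, S.cost α β γ u / 2 - l u ≤ S.cost α β γ v / 2 - l v := by
  obtain ⟨c, hc, hcoer⟩ := exists_energy_coercive S hα hβ
  -- The bound `b` is the minimum over `s` of `c s² / 2 - ‖l‖ s`; `c / 8` is half of the gain `c /
  -- 4` in `cost_midpoint_le`.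
  refine exists_minimizer_of_midpoint hA hAc hne
    (f := fun v => S.cost α β γ v / 2 - l v)
    ((continuous_cost.div_const 2).sub l.continuous) (b := -(‖l‖ ^ 2 / (2 * c)))
    (fun v _ => ?_) (m := c / 8) (by positivity) (fun x _ y _ => ?_)
  · have h1 := hcoer v
    have h2 : l v ≤ ‖l‖ * ‖v‖ := (le_abs_self _).trans (l.le_opNorm v)
    have h3 := L2Space.l1norm_nonneg (H10deriv v)
    have h4 : ‖l‖ * ‖v‖ ≤ c * ‖v‖ ^ 2 / 2 + ‖l‖ ^ 2 / (2 * c) := by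
      have : 0 ≤ (c * ‖v‖ - ‖l‖) ^ 2 / (2 * c) := by positivity
      have e : (c * ‖v‖ - ‖l‖) ^ 2 / (2 * c)
          = c * ‖v‖ ^ 2 / 2 + ‖l‖ ^ 2 / (2 * c) - ‖l‖ * ‖v‖ := by field_simp; ring
      linarith
    have h5 := mul_nonneg hγ h3
    rw [cost_eq]
    linarith
  · have h1 := cost_midpoint_le (α := α) (β := β) hγ x y
    have h2 := hcoer (x - y)
    simp only [map_add, map_smul, smul_eq_mul]
    linarith

end ControlSystem

/-! ### Linear differential equations and their flow. -/

section LinearODE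

variable {E : Type*} [NormedAddCommGroup E] [NormedSpace ℝ E]

/-- The flow `exp (t A)` of the equation `y' = A y`. -/
noncomputable def flow (A : E →L[ℝ] E) (t : ℝ) : E →L[ℝ] E := NormedSpace.exp (t • A)

theorem flow_zero (A : E →L[ℝ] E) : flow A 0 = 1 := by
  simp [flow, NormedSpace.exp_zero]

variable [CompleteSpace E]

theorem hasDerivAt_flow (A : E →L[ℝ] E) (t : ℝ) : HasDerivAt (flow A) (A * flow A t) t :=
  hasDerivAt_exp_smul_const' A t

theorem flow_mul_flow_neg (A : E →L[ℝ] E) (t : ℝ) : flow A t * flow A (-t) = 1 := by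
  have hc : Commute (t • A) ((-t) • A) := ((Commute.refl A).smul_left t).smul_right (-t)
  let : NormedAlgebra ℚ (E →L[ℝ] E) := NormedAlgebra.restrictScalars ℚ ℝ (E →L[ℝ] E)
  have h := NormedSpace.exp_add_of_commute hc
  rw [neg_smul, add_neg_cancel, NormedSpace.exp_zero, ← neg_smul] at h
  exact h.symm

theorem continuous_flow (A : E →L[ℝ] E) : Continuous (flow A) :=
  continuous_iff_continuousAt.2 fun t => (hasDerivAt_flow A t).continuousAt

theorem hasDerivAt_flow_apply (A : E →L[ℝ] E) (x : E) (t : ℝ) :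
    HasDerivAt (fun s => flow A s x) (A (flow A t x)) t :=
  (hasDerivAt_flow A t).clm_apply (hasDerivAt_const t x) |>.congr_deriv (by simp)

/-- The solutions of `y' = A y` are given by the flow. -/
theorem eq_flow_of_hasDerivAt {A : E →L[ℝ] E} {y : ℝ → E} (hy : ∀ t, HasDerivAt y (A (y t)) t)
    (t : ℝ) : y t = flow A t (y 0) := by
  have hA : LipschitzOnWith ‖A‖₊ A univ := A.lipschitz.lipschitzOnWith
  have h := ODE_solution_unique_univ (v := fun _ => A) (s := fun _ => univ) (K := ‖A‖₊)
    (f := y) (g := fun s => flow A s (y 0)) (t₀ := 0) (fun _ => hA)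
    (fun s => ⟨hy s, mem_univ _⟩) (fun s => ⟨hasDerivAt_flow_apply A (y 0) s, mem_univ _⟩)
    (by simp [flow_zero])
  exact congrFun h t

theorem hasDerivAt_clm_flow {F : Type*} [NormedAddCommGroup F] [NormedSpace ℝ F] (L : E →L[ℝ] F)
    (A : E →L[ℝ] E) (x : E) (t : ℝ) :
    HasDerivAt (fun s => L (flow A s x)) (L (A (flow A t x))) t :=
  L.hasFDerivAt.comp_hasDerivAt t (hasDerivAt_flow_apply A x t)

/-- A second order equation written as a first order system is solved by the flow. -/
theorem add_eq_flow_of_hasDerivAt {F : Type*} [NormedAddCommGroup F] [NormedSpace ℝ F]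
    (i j : F →L[ℝ] E) {A : E →L[ℝ] E} {q r a : ℝ → F} (hq : ∀ t, HasDerivAt q (r t) t)
    (hr : ∀ t, HasDerivAt r (a t) t) (h : ∀ t, i (r t) + j (a t) = A (i (q t) + j (r t))) (t : ℝ) :
    i (q t) + j (r t) = flow A t (i (q 0) + j (r 0)) := by
  refine eq_flow_of_hasDerivAt (y := fun s => i (q s) + j (r s)) (fun s => ?_) t
  rw [← h]
  exact (i.hasFDerivAt.comp_hasDerivAt s (hq s)).add (j.hasFDerivAt.comp_hasDerivAt s (hr s))

/-- Solvability of `y' = A y + g` in integrated form, for integrable `g`. -/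
theorem exists_integral_solution (A : E →L[ℝ] E) {g : ℝ → E} (hg : Integrable g) (y₀ : E) :
    ∃ y : ℝ → E, Continuous y ∧ ∀ t, y t = y₀ + ∫ s in (0 : ℝ)..t, (A (y s) + g s) := by
  -- Writing `y = z + G` replaces the merely integrable forcing by a continuous one, `z' = A z + A
  -- G`, which variation of constants solves in the classical sense.
  let G : ℝ → E := fun t => ∫ s in (0 : ℝ)..t, g s
  have hG : Continuous G := intervalIntegral.continuous_primitive (fun _ _ => hg.intervalIntegrable) 0
  let h : ℝ → E := fun s => flow A (-s) (A (G s))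
  have hh : Continuous h :=
    ((continuous_flow A).comp continuous_neg).clm_apply (A.continuous.comp hG)
  let H : ℝ → E := fun t => y₀ + ∫ s in (0 : ℝ)..t, h s
  have hH : ∀ t, HasDerivAt H (h t) t := fun t =>
    (intervalIntegral.integral_hasDerivAt_right (hh.intervalIntegrable _ _)
      (hh.stronglyMeasurableAtFilter _ _) hh.continuousAt).const_add y₀
  let z : ℝ → E := fun t => flow A t (H t)
  have hz : ∀ t, HasDerivAt z (A (z t) + A (G t)) t := fun t =>
    ((hasDerivAt_flow A t).clm_apply (hH t)).congr_deriv (by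
      have h1 : flow A t (flow A (-t) (A (G t))) = A (G t) :=
        congrArg (fun B : E →L[ℝ] E => B (A (G t))) (flow_mul_flow_neg A t)
      simp only [h, z, h1]
      rfl)
  have hzc : Continuous z := continuous_iff_continuousAt.2 fun t => (hz t).continuousAt
  refine ⟨fun t => z t + G t, hzc.add hG, fun t => ?_⟩
  have hi : Continuous fun s => A (z s) + A (G s) :=
    (A.continuous.comp hzc).add (A.continuous.comp hG)
  have e1 : ∫ s in (0 : ℝ)..t, (A (z s) + A (G s)) = z t - z 0 :=
    intervalIntegral.integral_eq_sub_of_hasDerivAt (fun s _ => hz s) (hi.intervalIntegrable _ _)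
  have e2 : z 0 = y₀ := by simp [z, H, flow_zero]
  simp only [map_add]
  rw [intervalIntegral.integral_add (hi.intervalIntegrable _ _) hg.intervalIntegrable, e1, e2]
  change z t + G t = y₀ + (z t - y₀ + G t)
  abel

/-- Grönwall's inequality, applied to the primitive of a continuous extension of `A y`: this
primitive is differentiable everywhere and equals `y` on `[0,T]`, so `y` itself need not be
differentiated. -/
theorem eq_zero_of_eq_integral {A : E →L[ℝ] E} {T : ℝ} {y : ℝ → E} (hT : 0 ≤ T)
    (hy : ContinuousOn y (Icc 0 T)) (h : ∀ t ∈ Icc 0 T, y t = ∫ s in (0 : ℝ)..t, A (y s)) :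
    ∀ t ∈ Icc 0 T, y t = 0 := by
  let Y : ℝ → E := fun s => A (IccExtend hT (domRestrict (Icc 0 T) y) s)
  have hY : Continuous Y := A.continuous.comp ((continuousOn_iff_continuous_domRestrict.1 hy).Icc_extend')
  have hYe : ∀ s ∈ Icc 0 T, Y s = A (y s) := fun s hs => by
    simp only [Y, IccExtend_of_mem hT _ hs]; rfl
  let w : ℝ → E := fun t => ∫ s in (0 : ℝ)..t, Y s
  have hw : ∀ t, HasDerivAt w (Y t) t := fun t =>
    intervalIntegral.integral_hasDerivAt_right (hY.intervalIntegrable _ _)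
      (hY.stronglyMeasurableAtFilter _ _) hY.continuousAt
  have hwy : ∀ t ∈ Icc 0 T, w t = y t := fun t ht => by
    rw [h t ht]
    refine intervalIntegral.integral_congr fun s hs => hYe s ?_
    rw [uIcc_of_le ht.1] at hs
    exact ⟨hs.1, hs.2.trans ht.2⟩
  have hz := eq_zero_of_abs_deriv_le_mul_abs_self_of_eq_zero_right (f := w) (f' := Y) (K := ‖A‖)
    (a := 0) (b := T) (fun t _ => (hw t).continuousAt.continuousWithinAt)
    (fun t _ => (hw t).hasDerivWithinAt) (by simp [w])
    (fun t ht => by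
      have ht' := Ico_subset_Icc_self ht
      rw [hYe t ht', hwy t ht']
      exact A.le_opNorm _)
  intro t ht
  rw [← hwy t ht]
  exact hz t ht

end LinearODE

/-! ### Integration by parts for primitives of integrable functions. -/

section ByParts

variable {T : ℝ}

/-- The primitive `P` of `f` is absolutely continuous with derivative `f` a.e., which suffices for
integration by parts. As `F` is prescribed on `[0,T]` only, the argument runs on `P`, and the
constant `c` is added separately. -/
theorem integral_mul_by_parts (hT : 0 ≤ T) {f F G G' : ℝ → ℝ} {c : ℝ}
    (hf : IntervalIntegrable f volume 0 T)
    (hF : ∀ t ∈ Icc 0 T, F t = c + ∫ s in (0 : ℝ)..t, f s)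
    (hG : ∀ t, HasDerivAt G (G' t) t) (hG' : Continuous G') :
    ∫ t in (0 : ℝ)..T, f t * G t = F T * G T - c * G 0 - ∫ t in (0 : ℝ)..T, F t * G' t := by
  have hu : uIcc 0 T = Icc 0 T := uIcc_of_le hT
  let P : ℝ → ℝ := fun t => ∫ s in (0 : ℝ)..t, f s
  have hPac : AbsolutelyContinuousOnInterval P 0 T :=
    hf.absolutelyContinuousOnInterval_intervalIntegral (by simp)
  have hderiv : deriv G = G' := funext fun t => (hG t).deriv
  have hGc : ContDiff ℝ 1 G := contDiff_one_iff_deriv.2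
    ⟨fun t => (hG t).differentiableAt, by rw [hderiv]; exact hG'⟩
  have hGac : AbsolutelyContinuousOnInterval G 0 T :=
    hGc.contDiffOn.absolutelyContinuousOnInterval
  have h := hGac.integral_mul_deriv_eq_deriv_mul hPac
  have e1 : ∫ t in (0 : ℝ)..T, G t * deriv P t = ∫ t in (0 : ℝ)..T, f t * G t := by
    refine intervalIntegral.integral_congr_ae ?_
    filter_upwards [hf.ae_hasDerivAt_integral] with t ht hts
    rw [(ht (uIoc_subset_uIcc hts) 0 (by simp)).deriv, mul_comm]
  have hGi : IntervalIntegrable G' volume 0 T := hG'.intervalIntegrable _ _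
  have e2 : ∫ t in (0 : ℝ)..T, F t * G' t
      = c * (G T - G 0) + ∫ t in (0 : ℝ)..T, deriv G t * P t := by
    rw [← intervalIntegral.integral_eq_sub_of_hasDerivAt (fun s _ => hG s) hGi,
      ← intervalIntegral.integral_const_mul, ← intervalIntegral.integral_add (hGi.const_mul c)]
    · refine intervalIntegral.integral_congr fun t ht => ?_
      rw [hu] at ht
      simp only [hF t ht, hderiv, P]
      ring
    · rw [hderiv]
      exact hGi.mul_continuousOn hPac.continuousOn
  rw [e1] at h
  rw [h, e2, hF T ⟨hT, le_rfl⟩]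
  have h0 : P 0 = 0 := by simp [P]
  rw [h0]
  change _ = (c + P T) * G T - _ - _
  ring

/-- Integration by parts for the scalar product of a primitive of an integrable function and a
`C¹` function. -/
theorem integral_inner_by_parts {n : ℕ} (hT : 0 ≤ T) {f F G G' : ℝ → Vec n} {c : Vec n}
    (hf : IntervalIntegrable f volume 0 T)
    (hF : ∀ t ∈ Icc 0 T, F t = c + ∫ s in (0 : ℝ)..t, f s)
    (hG : ∀ t, HasDerivAt G (G' t) t) (hG' : Continuous G') :
    ∫ t in (0 : ℝ)..T, inner ℝ (f t) (G t)
      = inner ℝ (F T) (G T) - inner ℝ c (G 0) - ∫ t in (0 : ℝ)..T, inner ℝ (F t) (G' t) := by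
  have hin : ∀ x y : Vec n, inner ℝ x y = ∑ i, x i * y i := fun x y => by
    rw [PiLp.inner_apply]
    exact Finset.sum_congr rfl fun i _ => by simp [mul_comm]
  have hpi : ∀ i, IntervalIntegrable (fun t => f t i) volume 0 T := fun i =>
    ⟨(EuclideanSpace.proj (𝕜 := ℝ) i).integrable_comp hf.1,
      (EuclideanSpace.proj (𝕜 := ℝ) i).integrable_comp hf.2⟩
  have hpF : ∀ i, ∀ t ∈ Icc 0 T, F t i = c i + ∫ s in (0 : ℝ)..t, f s i := fun i t ht => by
    have hft : IntervalIntegrable f volume 0 t :=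
      hf.mono_set (by rw [uIcc_of_le hT, uIcc_of_le ht.1]; exact Icc_subset_Icc_right ht.2)
    have h := (EuclideanSpace.proj (𝕜 := ℝ) i).intervalIntegral_comp_comm hft
    rw [hF t ht]
    change c i + (EuclideanSpace.proj (𝕜 := ℝ) i) (∫ s in (0 : ℝ)..t, f s) = _
    rw [← h]
    rfl
  have hpG : ∀ i t, HasDerivAt (fun s => G s i) (G' t i) t := fun i t =>
    (EuclideanSpace.proj (𝕜 := ℝ) i).hasFDerivAt.comp_hasDerivAt t (hG t)
  have hpG' : ∀ i, Continuous fun t => G' t i := fun i =>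
    (EuclideanSpace.proj (𝕜 := ℝ) i).continuous.comp hG'
  have hFc : ∀ i, ContinuousOn (fun t => F t i) (uIcc 0 T) := fun i => by
    have h1 : ContinuousOn (fun t => c i + ∫ s in (0 : ℝ)..t, f s i) (uIcc 0 T) :=
      continuousOn_const.add (intervalIntegral.continuousOn_primitive_interval' (hpi i) (by simp))
    exact h1.congr fun t ht => hpF i t (by rwa [uIcc_of_le hT] at ht)
  have hGcont : ∀ i, Continuous fun t => G t i := fun i =>
    continuous_iff_continuousAt.2 fun t => (hpG i t).continuousAt
  simp only [hin]
  rw [intervalIntegral.integral_finsetSum fun i _ => (hpi i).mul_continuousOn (hGcont i).continuousOn,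
    intervalIntegral.integral_finsetSum fun i _ =>
      (show IntervalIntegrable (fun t => F t i * G' t i) volume 0 T from
        ((hFc i).mul (hpG' i).continuousOn).intervalIntegrable),
    ← Finset.sum_sub_distrib, ← Finset.sum_sub_distrib]
  exact Finset.sum_congr rfl fun i _ =>
    integral_mul_by_parts hT (hpi i) (hpF i) (hpG i) (hpG' i)

theorem intervalIntegrable_of_timeMeasure (hT : 0 ≤ T) {E : Type*} [NormedAddCommGroup E]
    {f : ℝ → E} (hf : Integrable f (timeMeasure T)) : IntervalIntegrable f volume 0 T := by
  rw [intervalIntegrable_iff_integrableOn_Ioo_of_le hT]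
  exact hf

theorem intervalIntegral_eq_timeMeasure (hT : 0 ≤ T) {E : Type*} [NormedAddCommGroup E]
    [NormedSpace ℝ E] (f : ℝ → E) :
    ∫ t in (0 : ℝ)..T, f t = ∫ t, f t ∂(timeMeasure T) := by
  rw [intervalIntegral.integral_of_le hT, integral_Ioc_eq_integral_Ioo]

end ByParts

theorem Matrix.inner_toEuclideanLin_left {m n : ℕ} (A : Matrix (Fin m) (Fin n) ℝ) (x : Vec n)
    (y : Vec m) : inner ℝ (A.toEuclideanLin x) y = inner ℝ x (A.transpose.toEuclideanLin y) := by
  rw [← Matrix.conjTranspose_eq_transpose_of_trivial, Matrix.toEuclideanLin_conjTranspose_eq_adjoint,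
    LinearMap.adjoint_inner_right]

theorem Matrix.continuous_toEuclideanLin {m n : ℕ} (A : Matrix (Fin m) (Fin n) ℝ) :
    Continuous A.toEuclideanLin := A.toEuclideanLin.continuous_of_finiteDimensional

theorem continuousOn_of_eq_add_integral {T : ℝ} {n : ℕ} (hT : 0 ≤ T) {f F : ℝ → Vec n} {c : Vec n}
    (hf : IntervalIntegrable f volume 0 T)
    (hF : ∀ t ∈ Icc 0 T, F t = c + ∫ s in (0 : ℝ)..t, f s) : ContinuousOn F (Icc 0 T) := by
  have h1 : ContinuousOn (fun t => c + ∫ s in (0 : ℝ)..t, f s) (uIcc 0 T) :=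
    continuousOn_const.add (intervalIntegral.continuousOn_primitive_interval' hf (by simp))
  rw [uIcc_of_le hT] at h1
  exact h1.congr hF

theorem memLp_of_continuous {n : ℕ} {f : ℝ → Vec n} (hf : Continuous f) (T : ℝ) :
    MemLp f 2 (timeMeasure T) := by
  obtain ⟨C, hC⟩ := isCompact_Icc.exists_bound_of_continuousOn (s := Icc 0 T) hf.continuousOn
  refine MeasureTheory.MemLp.of_bound hf.aestronglyMeasurable C ?_
  filter_upwards [ae_restrict_mem measurableSet_Ioo] with t ht
  exact hC t (Ioo_subset_Icc_self ht)

/-- The half-open interval may contain the endpoint `T`, which the open interval misses; it is a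
null set. -/
theorem timeMeasure_ae_interval {T t : ℝ} (ht : t ∈ Icc 0 T) {P : ℝ → Prop}
    (h : ∀ᵐ s ∂(timeMeasure T), P s) : ∀ᵐ s, s ∈ uIoc 0 t → P s := by
  rw [ae_restrict_iff' measurableSet_Ioo] at h
  have h0 : ∀ᵐ s : ℝ, s ≠ T := by simp [ae_iff]
  filter_upwards [h, h0] with s hs hsT hst
  rw [uIoc_of_le ht.1] at hst
  exact hs ⟨hst.1, lt_of_le_of_ne (hst.2.trans ht.2) hsT⟩

theorem intervalIntegrable_of_mem {T t : ℝ} (ht : t ∈ Icc 0 T) {E : Type*} [NormedAddCommGroup E]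
    {f : ℝ → E} (hf : IntervalIntegrable f volume 0 T) : IntervalIntegrable f volume 0 t :=
  hf.mono_set (by
    rw [uIcc_of_le (ht.1.trans ht.2), uIcc_of_le ht.1]
    exact Icc_subset_Icc_right ht.2)

/-! ### Phase space. -/

/-- The phase space of positions and velocities. -/
abbrev Phase (n : ℕ) : Type := WithLp 2 (Vec n × Vec n)

namespace Phase

variable {n : ℕ}

theorem ext {x y : Phase n} (h₁ : x.fst = y.fst) (h₂ : x.snd = y.snd) : x = y :=
  (WithLp.equiv 2 (Vec n × Vec n)).injective (Prod.ext h₁ h₂)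

theorem inner_eq (x y : Phase n) : inner ℝ x y = inner ℝ x.fst y.fst + inner ℝ x.snd y.snd :=
  WithLp.prod_inner_apply x y

/-- The position. -/
noncomputable def fstL (n : ℕ) : Phase n →L[ℝ] Vec n := WithLp.fstL 2 ℝ (Vec n) (Vec n)

/-- The velocity. -/
noncomputable def sndL (n : ℕ) : Phase n →L[ℝ] Vec n := WithLp.sndL 2 ℝ (Vec n) (Vec n)

theorem fstL_apply (x : Phase n) : fstL n x = x.fst := rfl

theorem sndL_apply (x : Phase n) : sndL n x = x.snd := rfl

/-- The continuous linear map `(x, v) ↦ (x, v)` to the phase space. -/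
noncomputable def toLpL (n : ℕ) : Vec n × Vec n →L[ℝ] Phase n :=
  (WithLp.prodContinuousLinearEquiv 2 ℝ (Vec n) (Vec n)).symm.toContinuousLinearMap

/-- The inclusion of the positions. -/
noncomputable def inlL (n : ℕ) : Vec n →L[ℝ] Phase n :=
  (toLpL n).comp (ContinuousLinearMap.inl ℝ (Vec n) (Vec n))

/-- The inclusion of the velocities. -/
noncomputable def inrL (n : ℕ) : Vec n →L[ℝ] Phase n :=
  (toLpL n).comp (ContinuousLinearMap.inr ℝ (Vec n) (Vec n))

theorem inlL_add_inrL (x v : Vec n) : inlL n x + inrL n v = WithLp.toLp 2 (x, v) :=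
  ext (add_zero x) (zero_add v)

/-- The pairing of two linear maps. -/
noncomputable def pairL (f g : Phase n →L[ℝ] Vec n) : Phase n →L[ℝ] Phase n :=
  (toLpL n).comp (f.prod g)

end Phase

namespace ControlSystem

variable {N p : ℕ} (S : ControlSystem N p)

theorem M_inv_M (x : Vec N) : S.M⁻¹.toEuclideanLin (S.M.toEuclideanLin x) = x := by
  have h : IsUnit S.M.det := (Matrix.isUnit_iff_isUnit_det _).1 S.M_posDef.isUnit
  simp only [Matrix.toLpLin_apply, Matrix.mulVec_mulVec, Matrix.nonsing_inv_mul _ h,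
    Matrix.one_mulVec]

theorem M_M_inv (x : Vec N) : S.M.toEuclideanLin (S.M⁻¹.toEuclideanLin x) = x := by
  have h : IsUnit S.M.det := (Matrix.isUnit_iff_isUnit_det _).1 S.M_posDef.isUnit
  simp only [Matrix.toLpLin_apply, Matrix.mulVec_mulVec, Matrix.mul_nonsing_inv _ h,
    Matrix.one_mulVec]

theorem M_injective : Function.Injective S.M.toEuclideanLin :=
  Function.LeftInverse.injective S.M_inv_M

theorem inner_M_left (x y : Vec N) :
    inner ℝ (S.M.toEuclideanLin x) y = inner ℝ x (S.M.toEuclideanLin y) := by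
  have h : S.M.transpose = S.M := by
    rw [← Matrix.conjTranspose_eq_transpose_of_trivial]
    exact S.M_posDef.1
  rw [Matrix.inner_toEuclideanLin_left, h]

/-! ### The adjoint equation -/

/-- The generator of the adjoint equation written as a first order system. -/
noncomputable def adjointGen : Phase N →L[ℝ] Phase N :=
  Phase.pairL (Phase.sndL N)
    (S.M⁻¹.toEuclideanLin.toContinuousLinearMap ∘L
      (S.C.transpose.toEuclideanLin.toContinuousLinearMap ∘L Phase.sndL N
        - S.K.transpose.toEuclideanLin.toContinuousLinearMap ∘L Phase.fstL N))

theorem adjointGen_snd (x : Phase N) : (S.adjointGen x).snd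
    = S.M⁻¹.toEuclideanLin (S.C.transpose.toEuclideanLin x.snd
      - S.K.transpose.toEuclideanLin x.fst) := rfl

theorem hasDerivAt_adjoint_fst (Ψ : Phase N) (t : ℝ) :
    HasDerivAt (fun s => (flow S.adjointGen s Ψ).fst) (flow S.adjointGen t Ψ).snd t :=
  hasDerivAt_clm_flow (Phase.fstL N) S.adjointGen Ψ t

theorem hasDerivAt_adjoint_snd (Ψ : Phase N) (t : ℝ) :
    HasDerivAt (fun s => (flow S.adjointGen s Ψ).snd)
      (S.adjointGen (flow S.adjointGen t Ψ)).snd t :=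
  hasDerivAt_clm_flow (Phase.sndL N) S.adjointGen Ψ t

theorem continuous_adjoint_flow (Ψ : Phase N) : Continuous fun t => flow S.adjointGen t Ψ :=
  (continuous_flow _).clm_apply continuous_const

theorem continuous_adjoint_fst (Ψ : Phase N) :
    Continuous fun t => (flow S.adjointGen t Ψ).fst :=
  (Phase.fstL N).continuous.comp (S.continuous_adjoint_flow Ψ)

theorem continuous_adjoint_snd (Ψ : Phase N) :
    Continuous fun t => (flow S.adjointGen t Ψ).snd :=
  (Phase.sndL N).continuous.comp (S.continuous_adjoint_flow Ψ)

theorem continuous_adjoint_acc (Ψ : Phase N) :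
    Continuous fun t => (S.adjointGen (flow S.adjointGen t Ψ)).snd :=
  (Phase.sndL N).continuous.comp (S.adjointGen.continuous.comp (S.continuous_adjoint_flow Ψ))

theorem isAdjoint_flow (Ψ : Phase N) : S.IsAdjoint Ψ fun t => (flow S.adjointGen t Ψ).fst := by
  have h1 : deriv (fun t => (flow S.adjointGen t Ψ).fst) = fun t => (flow S.adjointGen t Ψ).snd :=
    funext fun t => (S.hasDerivAt_adjoint_fst Ψ t).deriv
  have h2 : deriv (fun t => (flow S.adjointGen t Ψ).snd)
      = fun t => (S.adjointGen (flow S.adjointGen t Ψ)).snd :=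
    funext fun t => (S.hasDerivAt_adjoint_snd Ψ t).deriv
  refine ⟨?_, by simp [flow_zero], by rw [h1]; simp [flow_zero], fun t => ?_⟩
  · have : ContDiff ℝ (1 + 1) fun t => (flow S.adjointGen t Ψ).fst := by
      rw [contDiff_succ_iff_deriv, h1, contDiff_one_iff_deriv, h2]
      exact ⟨fun t => (S.hasDerivAt_adjoint_fst Ψ t).differentiableAt, by simp,
        fun t => (S.hasDerivAt_adjoint_snd Ψ t).differentiableAt, S.continuous_adjoint_acc Ψ⟩
    simpa only [one_add_one_eq_two] using this
  · simp only [h1, h2, adjointGen_snd, M_M_inv]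
    abel

theorem IsAdjoint.eq_flow {S : ControlSystem N p} {Ψ : Phase N} {Q : ℝ → Vec N}
    (h : S.IsAdjoint Ψ Q) : Q = fun t => (flow S.adjointGen t Ψ).fst := by
  obtain ⟨hc, h0, h1, heq⟩ := h
  have hQ : ∀ t, HasDerivAt Q (deriv Q t) t := fun t =>
    ((hc.differentiable (by simp)) t).hasDerivAt
  have hQ' : ∀ t, HasDerivAt (deriv Q) (deriv (deriv Q) t) t := fun t => by
    have hc' : ContDiff ℝ (1 + 1) Q := by simpa only [one_add_one_eq_two] using hc
    exact (((contDiff_succ_iff_deriv.1 hc').2.2.differentiable (by simp)) t).hasDerivAt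
  have key := add_eq_flow_of_hasDerivAt (Phase.inlL N) (Phase.inrL N) (A := S.adjointGen) hQ hQ'
    (fun t => by
      have h3 : S.C.transpose.toEuclideanLin (deriv Q t) - S.K.transpose.toEuclideanLin (Q t)
          = S.M.toEuclideanLin (deriv (deriv Q) t) := by
        have := heq t
        rw [← sub_eq_zero, ← neg_eq_zero, ← this]
        abel
      rw [Phase.inlL_add_inrL, Phase.inlL_add_inrL]
      refine Phase.ext rfl ?_
      rw [adjointGen_snd]
      change deriv (deriv Q) t = S.M⁻¹.toEuclideanLin (S.C.transpose.toEuclideanLin (deriv Q t)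
        - S.K.transpose.toEuclideanLin (Q t))
      rw [h3, M_inv_M])
  simp only [Phase.inlL_add_inrL, h0, h1] at key
  funext t
  exact congrArg WithLp.fst (key t)

/-- Uniqueness turns the choice made in `adjointState` into a formula that is visibly linear in `Ψ`.
-/
theorem adjointState_eq (Ψ : Phase N) :
    S.adjointState Ψ = fun t => (flow S.adjointGen t Ψ).fst :=
  (Classical.epsilon_spec ⟨_, S.isAdjoint_flow Ψ⟩ : S.IsAdjoint Ψ (S.adjointState Ψ)).eq_flow

theorem existsUnique_adjoint (Ψ : Phase N) : ∃! Q : ℝ → Vec N, S.IsAdjoint Ψ Q :=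
  ⟨_, S.isAdjoint_flow Ψ, fun _ h => h.eq_flow⟩

end ControlSystem

namespace ControlSystem

variable {N p : ℕ} (S : ControlSystem N p)

/-! ### The state equation -/

/-- The generator of the state equation written as a first order system. -/
noncomputable def stateGen : Phase N →L[ℝ] Phase N :=
  Phase.pairL (Phase.sndL N)
    (-(S.M⁻¹.toEuclideanLin.toContinuousLinearMap ∘L
      (S.C.toEuclideanLin.toContinuousLinearMap ∘L Phase.sndL N
        + S.K.toEuclideanLin.toContinuousLinearMap ∘L Phase.fstL N)))

theorem stateGen_snd (x : Phase N) : (S.stateGen x).snd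
    = -S.M⁻¹.toEuclideanLin (S.C.toEuclideanLin x.snd + S.K.toEuclideanLin x.fst) := rfl

theorem integrable_L2 {T : ℝ} {n : ℕ} (w : L2 T n) : Integrable w (timeMeasure T) :=
  (Lp.memLp w).integrable (by norm_num)

theorem intervalIntegrable_L2 {T : ℝ} {n : ℕ} (hT : 0 ≤ T) (w : L2 T n) :
    IntervalIntegrable w volume 0 T :=
  intervalIntegrable_of_timeMeasure hT (integrable_L2 w)

variable {S}

theorem IsState.continuousOn_snd {D : LoadData S.T N} {u : S.Control} {X V : ℝ → Vec N}
    (h : S.IsState D u X V) : ContinuousOn V (Icc 0 S.T) := by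
  obtain ⟨A, -, hV, -⟩ := h
  exact continuousOn_of_eq_add_integral S.T_pos.le (intervalIntegrable_L2 S.T_pos.le A) hV

theorem IsState.intervalIntegrable_snd {D : LoadData S.T N} {u : S.Control} {X V : ℝ → Vec N}
    (h : S.IsState D u X V) : IntervalIntegrable V volume 0 S.T :=
  ContinuousOn.intervalIntegrable (by rw [uIcc_of_le S.T_pos.le]; exact h.continuousOn_snd)

theorem IsState.continuousOn_fst {D : LoadData S.T N} {u : S.Control} {X V : ℝ → Vec N}
    (h : S.IsState D u X V) : ContinuousOn X (Icc 0 S.T) :=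
  continuousOn_of_eq_add_integral S.T_pos.le h.intervalIntegrable_snd
    (by obtain ⟨A, hX, -⟩ := h; exact hX)

/-- Load and control cancel in the difference of two solutions. Invertibility of `M` gives the
difference of accelerations a.e., so the phase difference solves a homogeneous integral equation. -/
theorem IsState.unique {D : LoadData S.T N} {u : S.Control} {X V X' V' : ℝ → Vec N}
    (h : S.IsState D u X V) (h' : S.IsState D u X' V') :
    EqOn X' X (Icc 0 S.T) ∧ EqOn V' V (Icc 0 S.T) := by
  have hT := S.T_pos.le
  have cX := h'.continuousOn_fst.sub h.continuousOn_fst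
  have cV := h'.continuousOn_snd.sub h.continuousOn_snd
  have iV := h.intervalIntegrable_snd
  have iV' := h'.intervalIntegrable_snd
  obtain ⟨A, hX, hV, hA⟩ := h
  obtain ⟨A', hX', hV', hA'⟩ := h'
  let d : ℝ → Phase N := fun t => WithLp.toLp 2 (X' t - X t, V' t - V t)
  have hd : ContinuousOn d (Icc 0 S.T) :=
    (WithLp.prodContinuousLinearEquiv 2 ℝ (Vec N) (Vec N)).symm.continuous.comp_continuousOn
      (cX.prodMk cV)
  have hdi : IntervalIntegrable (fun s => S.stateGen (d s)) volume 0 S.T :=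
    ContinuousOn.intervalIntegrable (by
      rw [uIcc_of_le hT]; exact S.stateGen.continuous.comp_continuousOn hd)
  have hacc : ∀ᵐ t ∂(timeMeasure S.T), A' t - A t = (S.stateGen (d t)).snd := by
    filter_upwards [hA, hA'] with t h1 h2
    rw [stateGen_snd]
    apply S.M_injective
    rw [map_neg, M_M_inv]
    change S.M.toEuclideanLin (A' t - A t)
      = -(S.C.toEuclideanLin (V' t - V t) + S.K.toEuclideanLin (X' t - X t))
    rw [← h1] at h2
    simp only [map_sub]
    rw [← sub_eq_zero] at h2 ⊢
    rw [← h2]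
    abel
  have key := eq_zero_of_eq_integral (A := S.stateGen) (y := d) hT hd (fun t ht => by
    have hdt := intervalIntegrable_of_mem ht hdi
    have hAt := intervalIntegrable_of_mem ht (intervalIntegrable_L2 hT A)
    have hAt' := intervalIntegrable_of_mem ht (intervalIntegrable_L2 hT A')
    apply Phase.ext
    · rw [← Phase.fstL_apply (∫ s in (0 : ℝ)..t, S.stateGen (d s)),
        ← (Phase.fstL N).intervalIntegral_comp_comm hdt]
      change X' t - X t = ∫ s in (0 : ℝ)..t, (V' s - V s)
      rw [intervalIntegral.integral_sub (intervalIntegrable_of_mem ht iV')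
        (intervalIntegrable_of_mem ht iV), hX t ht, hX' t ht]
      abel
    · rw [← Phase.sndL_apply (∫ s in (0 : ℝ)..t, S.stateGen (d s)),
        ← (Phase.sndL N).intervalIntegral_comp_comm hdt]
      have e : ∫ s in (0 : ℝ)..t, (Phase.sndL N) (S.stateGen (d s))
          = ∫ s in (0 : ℝ)..t, (A' s - A s) := by
        refine intervalIntegral.integral_congr_ae ?_
        filter_upwards [timeMeasure_ae_interval ht hacc] with s hs hst
        exact (hs hst).symm
      rw [e, intervalIntegral.integral_sub hAt' hAt]
      change V' t - V t = _
      rw [hV t ht, hV' t ht]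
      abel)
  constructor
  · intro t ht
    have := congrArg WithLp.fst (key t ht)
    exact sub_eq_zero.1 this
  · intro t ht
    have := congrArg WithLp.snd (key t ht)
    exact sub_eq_zero.1 this

variable (S)

theorem exists_isState (D : LoadData S.T N) (u : S.Control) :
    ∃ X V : ℝ → Vec N, S.IsState D u X V := by
  have hT := S.T_pos.le
  let w : ℝ → Vec N := fun t =>
    S.M⁻¹.toEuclideanLin (D.F t + S.B.toEuclideanLin (H10val u t))
  have hw : MemLp w 2 (timeMeasure S.T) := by
    have h1 := S.B.toEuclideanLin.toContinuousLinearMap.comp_memLp (H10val u)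
    exact S.M⁻¹.toEuclideanLin.toContinuousLinearMap.comp_memLp' ((Lp.memLp D.F).add h1)
  let ι : Vec N →L[ℝ] Phase N :=
    (WithLp.prodContinuousLinearEquiv 2 ℝ (Vec N) (Vec N)).symm.toContinuousLinearMap.comp
      (ContinuousLinearMap.inr ℝ (Vec N) (Vec N))
  -- The forcing is extended by zero to be integrable on the whole line.
  let g : ℝ → Phase N := (Ioo 0 S.T).indicator fun t => ι (w t)
  have hg : Integrable g := by
    rw [integrable_indicator_iff measurableSet_Ioo]
    exact ι.integrable_comp (hw.integrable (by norm_num))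
  obtain ⟨y, hyc, hy⟩ := exists_integral_solution S.stateGen hg (WithLp.toLp 2 (D.X₀, D.X₁))
  have hXc : Continuous fun t => (y t).fst := (Phase.fstL N).continuous.comp hyc
  have hVc : Continuous fun t => (y t).snd := (Phase.sndL N).continuous.comp hyc
  have hgen : Continuous fun t => S.stateGen (y t) := S.stateGen.continuous.comp hyc
  have hacc : MemLp (fun t => (S.stateGen (y t)).snd + w t) 2 (timeMeasure S.T) :=
    (memLp_of_continuous ((Phase.sndL N).continuous.comp hgen) S.T).add hw
  have hgs : ∀ᵐ t ∂(timeMeasure S.T), g t = ι (w t) := by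
    filter_upwards [ae_restrict_mem measurableSet_Ioo] with t ht
    exact indicator_of_mem ht _
  have hi : ∀ t, IntervalIntegrable (fun s => S.stateGen (y s) + g s) volume 0 t := fun t =>
    (hgen.intervalIntegrable _ _).add hg.intervalIntegrable
  refine ⟨fun t => (y t).fst, fun t => (y t).snd, hacc.toLp _, fun t ht => ?_, fun t ht => ?_, ?_⟩
  · change Phase.fstL N (y t) = _
    rw [hy t, map_add, ← (Phase.fstL N).intervalIntegral_comp_comm (hi t)]
    congr 1
    refine intervalIntegral.integral_congr_ae ?_
    filter_upwards [timeMeasure_ae_interval ht hgs] with s hs hst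
    rw [hs hst, map_add]
    change (y s).snd + 0 = _
    rw [add_zero]
  · change Phase.sndL N (y t) = _
    rw [hy t, map_add, ← (Phase.sndL N).intervalIntegral_comp_comm (hi t)]
    congr 1
    refine intervalIntegral.integral_congr_ae ?_
    filter_upwards [timeMeasure_ae_interval ht hgs, timeMeasure_ae_interval ht hacc.coeFn_toLp]
      with s hs hs' hst
    rw [hs hst, map_add, hs' hst]
    rfl
  · filter_upwards [hacc.coeFn_toLp] with t ht
    rw [ht, stateGen_snd, map_add, map_neg, M_M_inv, M_M_inv]
    abel

theorem isState_state (D : LoadData S.T N) (u : S.Control) :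
    S.IsState D u (S.state D u).1 (S.state D u).2 := by
  obtain ⟨X, V, h⟩ := S.exists_isState D u
  exact Classical.epsilon_spec (p := fun Z : (ℝ → Vec N) × (ℝ → Vec N) => S.IsState D u Z.1 Z.2)
    ⟨(X, V), h⟩

variable {S}

/-- The duality formula between the state and the adjoint state. -/
theorem IsState.duality {D : LoadData S.T N} {u : S.Control} {X V : ℝ → Vec N}
    (h : S.IsState D u X V) (δ : Phase N) :
    S.adjointPairing δ u + (∫ t, inner ℝ (D.F t) (S.adjointState δ t) ∂(timeMeasure S.T))
      + inner ℝ (S.M.toEuclideanLin D.X₁ + S.C.toEuclideanLin D.X₀) δ.fst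
      - inner ℝ (S.M.toEuclideanLin D.X₀) δ.snd
      = inner ℝ (S.M.toEuclideanLin (V S.T) + S.C.toEuclideanLin (X S.T))
          (flow S.adjointGen S.T δ).fst
        - inner ℝ (S.M.toEuclideanLin (X S.T)) (flow S.adjointGen S.T δ).snd := by
  have hT := S.T_pos.le
  have cX := h.continuousOn_fst
  have cV := h.continuousOn_snd
  have iV := h.intervalIntegrable_snd
  obtain ⟨A, hX, hV, hA⟩ := h
  let q : ℝ → Vec N := fun t => (flow S.adjointGen t δ).fst
  let r : ℝ → Vec N := fun t => (flow S.adjointGen t δ).snd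
  let a : ℝ → Vec N := fun t => (S.adjointGen (flow S.adjointGen t δ)).snd
  have hq : ∀ t, HasDerivAt q (r t) t := S.hasDerivAt_adjoint_fst δ
  have hr : ∀ t, HasDerivAt r (a t) t := S.hasDerivAt_adjoint_snd δ
  have cq : Continuous q := S.continuous_adjoint_fst δ
  have cr : Continuous r := S.continuous_adjoint_snd δ
  have ca : Continuous a := S.continuous_adjoint_acc δ
  have lin : ∀ (B : Matrix (Fin N) (Fin N) ℝ) {f f' : ℝ → Vec N},
      (∀ t, HasDerivAt f (f' t) t) →
      ∀ t, HasDerivAt (fun s => B.toEuclideanLin (f s)) (B.toEuclideanLin (f' t)) t :=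
    fun B f f' hf t =>
      B.toEuclideanLin.toContinuousLinearMap.hasFDerivAt.comp_hasDerivAt t (hf t)
  have clin : ∀ (B : Matrix (Fin N) (Fin N) ℝ) {f : ℝ → Vec N}, Continuous f →
      Continuous fun s => B.toEuclideanLin (f s) :=
    fun B f hf => B.continuous_toEuclideanLin.comp hf
  -- `p1` and `p2` move both derivatives of the inertia term onto `Q`, and `p3` the one of the
  -- damping term. What remains under the integral is `X` against the adjoint equation, hence zero.
  have p1 := integral_inner_by_parts hT (intervalIntegrable_L2 hT A) hV (lin S.M hq) (clin S.M cr)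
  have p2 := integral_inner_by_parts hT iV hX (lin S.M hr) (clin S.M ca)
  have p3 := integral_inner_by_parts hT iV hX (lin S.C.transpose hq) (clin S.C.transpose cr)
  have ode : ∀ t, S.M.toEuclideanLin (a t)
      = S.C.transpose.toEuclideanLin (r t) - S.K.transpose.toEuclideanLin (q t) := fun t =>
    S.M_M_inv _
  -- integrability of the scalar products
  have icc : ∀ {f g : ℝ → Vec N}, ContinuousOn f (Icc 0 S.T) → Continuous g →
      IntervalIntegrable (fun t => inner ℝ (f t) (g t)) volume 0 S.T := fun hf hg =>
    ContinuousOn.intervalIntegrable (by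
      rw [uIcc_of_le hT]; exact hf.inner hg.continuousOn)
  have iL2 : ∀ (w : L2 S.T N) {g : ℝ → Vec N}, Continuous g →
      IntervalIntegrable (fun t => inner ℝ (w t) (g t)) volume 0 S.T := fun w g hg => by
    refine intervalIntegrable_of_timeMeasure hT ?_
    refine (L2.integrable_inner (𝕜 := ℝ) w ((memLp_of_continuous hg S.T).toLp g)).congr ?_
    filter_upwards [(memLp_of_continuous hg S.T).coeFn_toLp] with t ht
    rw [ht]
  have iB : IntervalIntegrable
      (fun t => inner ℝ (S.B.transpose.toEuclideanLin (q t)) (H10val u t)) volume 0 S.T := by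
    have hc : Continuous fun t => S.B.transpose.toEuclideanLin (q t) :=
      S.B.transpose.continuous_toEuclideanLin.comp cq
    refine intervalIntegrable_of_timeMeasure hT ?_
    refine (L2.integrable_inner (𝕜 := ℝ) ((memLp_of_continuous hc S.T).toLp _) (H10val u)).congr ?_
    filter_upwards [(memLp_of_continuous hc S.T).coeFn_toLp] with t ht
    rw [ht]
  have main : (∫ t in (0 : ℝ)..S.T, inner ℝ (A t) (S.M.toEuclideanLin (q t)))
      + (∫ t in (0 : ℝ)..S.T, inner ℝ (V t) (S.C.transpose.toEuclideanLin (q t)))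
      + (∫ t in (0 : ℝ)..S.T, inner ℝ (X t) (S.K.transpose.toEuclideanLin (q t)))
      = (∫ t in (0 : ℝ)..S.T, inner ℝ (D.F t) (q t))
        + ∫ t in (0 : ℝ)..S.T, inner ℝ (S.B.transpose.toEuclideanLin (q t)) (H10val u t) := by
    rw [← intervalIntegral.integral_add (iL2 A (clin S.M cq)) (icc cV (clin S.C.transpose cq)),
      ← intervalIntegral.integral_add
        ((iL2 A (clin S.M cq)).add (icc cV (clin S.C.transpose cq))) (icc cX (clin S.K.transpose cq)),
      ← intervalIntegral.integral_add (iL2 D.F cq) iB,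
      intervalIntegral_eq_timeMeasure hT, intervalIntegral_eq_timeMeasure hT]
    refine integral_congr_ae ?_
    filter_upwards [hA] with t ht
    have := congrArg (fun x => inner ℝ x (q t)) ht
    simp only [inner_add_left] at this
    rw [S.inner_M_left, Matrix.inner_toEuclideanLin_left, Matrix.inner_toEuclideanLin_left,
      Matrix.inner_toEuclideanLin_left,
      real_inner_comm (S.B.transpose.toEuclideanLin (q t)) (H10val u t)] at this
    exact this
  have e : (∫ t in (0 : ℝ)..S.T, inner ℝ (X t) (S.M.toEuclideanLin (a t)))
      = (∫ t in (0 : ℝ)..S.T, inner ℝ (X t) (S.C.transpose.toEuclideanLin (r t)))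
        - ∫ t in (0 : ℝ)..S.T, inner ℝ (X t) (S.K.transpose.toEuclideanLin (q t)) := by
    rw [← intervalIntegral.integral_sub (icc cX (clin S.C.transpose cr))
      (icc cX (clin S.K.transpose cq))]
    refine intervalIntegral.integral_congr fun t _ => ?_
    simp only [ode, inner_sub_right]
  have q0 : q 0 = δ.fst := by simp [q, flow_zero]
  have r0 : r 0 = δ.snd := by simp [r, flow_zero]
  simp only [q0, r0] at p1 p2 p3
  rw [adjointPairing, S.adjointState_eq, ← intervalIntegral_eq_timeMeasure hT,
    ← intervalIntegral_eq_timeMeasure hT]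
  change (∫ t in (0 : ℝ)..S.T, inner ℝ (S.B.transpose.toEuclideanLin (q t)) (H10val u t))
    + (∫ t in (0 : ℝ)..S.T, inner ℝ (D.F t) (q t)) + _ - _ = inner ℝ _ (q S.T) - inner ℝ _ (r S.T)
  rw [inner_add_left, inner_add_left, S.inner_M_left, S.inner_M_left, S.inner_M_left,
    S.inner_M_left, Matrix.inner_toEuclideanLin_left, Matrix.inner_toEuclideanLin_left]
  linarith

end ControlSystem

/-! ### Finite-dimensional linear algebra. -/

section FiniteDimensional

variable {E : Type*} [NormedAddCommGroup E]

/-- A linear map on a finite-dimensional normed space, as a continuous linear map. -/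
noncomputable def clmOfFinite [NormedSpace ℝ E] [FiniteDimensional ℝ E] {F : Type*}
    [NormedAddCommGroup F] [NormedSpace ℝ F] (f : E →ₗ[ℝ] F) : E →L[ℝ] F :=
  LinearMap.toContinuousLinearMap f

theorem exists_clm_leftInverse [NormedSpace ℝ E] [FiniteDimensional ℝ E] {f : E →L[ℝ] E}
    (hf : Function.Injective f) : ∃ g : E →L[ℝ] E, ∀ x, g (f x) = x :=
  ⟨clmOfFinite (LinearEquiv.ofInjectiveEndo f.toLinearMap hf).symm.toLinearMap,
    fun x => (LinearEquiv.ofInjectiveEndo f.toLinearMap hf).symm_apply_apply x⟩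

/-- A linear functional vanishing on the kernel of a map to a Euclidean space factors through it. -/
theorem exists_inner_eq_of_ker_le [InnerProductSpace ℝ E] [FiniteDimensional ℝ E] {H : Type*}
    [AddCommGroup H] [Module ℝ H] (f : H →ₗ[ℝ] E) (R : H →ₗ[ℝ] ℝ) (h : ∀ w, f w = 0 → R w = 0) :
    ∃ Φ : E, ∀ v, R v = inner ℝ Φ (f v) := by
  have hR : R ∈ LinearMap.range f.dualMap := by
    rw [LinearMap.range_dualMap_eq_dualAnnihilator_ker, Submodule.mem_dualAnnihilator]
    exact h
  obtain ⟨φ, hφ⟩ := hR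
  have : CompleteSpace E := FiniteDimensional.complete ℝ E
  refine ⟨(InnerProductSpace.toDual ℝ E).symm (LinearMap.toContinuousLinearMap φ), fun v => ?_⟩
  rw [InnerProductSpace.toDual_symm_apply]
  exact (LinearMap.congr_fun hφ v).symm

end FiniteDimensional

namespace ControlSystem

variable {N p : ℕ} (S : ControlSystem N p)

/-! ### The reachability map -/

/-- The adjoint state as an element of `L²`, linearly in the initial data. -/
noncomputable def adjointL2 : Phase N →ₗ[ℝ] L2 S.T N where
  toFun δ := (memLp_of_continuous (S.continuous_adjoint_fst δ) S.T).toLp _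
  map_add' x y := by
    rw [← MemLp.toLp_add]
    exact MemLp.toLp_congr _ _ (Eventually.of_forall fun t => by
      simp only [map_add, WithLp.add_fst, Pi.add_apply])
  map_smul' c x := by
    rw [RingHom.id_apply, ← MemLp.toLp_const_smul]
    exact MemLp.toLp_congr _ _ (Eventually.of_forall fun t => by
      simp only [map_smul, WithLp.smul_fst, Pi.smul_apply])

theorem adjointL2_ae (δ : Phase N) :
    S.adjointL2 δ =ᵐ[timeMeasure S.T] S.adjointState δ := by
  rw [S.adjointState_eq]
  exact (memLp_of_continuous (S.continuous_adjoint_fst δ) S.T).coeFn_toLp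

/-- The observation `δ ↦ ᵗB Q(δ)`. -/
noncomputable def observation : Phase N →L[ℝ] L2 S.T p :=
  (S.B.transpose.toEuclideanLin.toContinuousLinearMap.compLpL 2 (timeMeasure S.T)).comp
    (clmOfFinite S.adjointL2)

theorem inner_observation (δ : Phase N) (v : S.Control) :
    inner ℝ (S.observation δ) (H10val v) = S.adjointPairing δ v := by
  rw [L2.inner_def, adjointPairing]
  refine integral_congr_ae ?_
  filter_upwards [S.adjointL2_ae δ, ContinuousLinearMap.coeFn_compLpL (p := 2)
    (S.B.transpose.toEuclideanLin.toContinuousLinearMap) (S.adjointL2 δ)] with t h1 h2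
  rw [← h1]
  exact congrArg (fun x => inner ℝ x (H10val v t)) h2

/-- The map `P` with `(P v, δ) = -∫ (ᵗB Q(δ), v)`. -/
noncomputable def reach : S.Control →L[ℝ] Phase N :=
  -((ContinuousLinearMap.adjoint S.observation).comp (H10.valL S.T p))

theorem inner_reach (v : S.Control) (δ : Phase N) :
    inner ℝ (S.reach v) δ = -S.adjointPairing δ v := by
  change inner ℝ (-(ContinuousLinearMap.adjoint S.observation (H10val v))) δ = _
  rw [inner_neg_left, ContinuousLinearMap.adjoint_inner_left, real_inner_comm,
    inner_observation]

/-- The vector `L`. -/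
noncomputable def loadVector (D : LoadData S.T N) : Phase N :=
  ContinuousLinearMap.adjoint (clmOfFinite S.adjointL2) D.F
    + WithLp.toLp 2 (S.M.toEuclideanLin D.X₁ + S.C.toEuclideanLin D.X₀, -S.M.toEuclideanLin D.X₀)

theorem isLoadVector_loadVector (D : LoadData S.T N) : S.IsLoadVector D (S.loadVector D) := by
  intro δ
  rw [loadVector, inner_add_left, ContinuousLinearMap.adjoint_inner_left, Phase.inner_eq,
    WithLp.toLp_fst, WithLp.toLp_snd, inner_neg_left, ← sub_eq_add_neg, ← add_sub_assoc,
    L2.inner_def]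
  congr 2
  refine integral_congr_ae ?_
  filter_upwards [S.adjointL2_ae δ] with t h1
  rw [← h1]
  rfl

/-- The isomorphism between the final state and the defect `P v - L`. -/
noncomputable def terminal : Phase N →L[ℝ] Phase N :=
  -((ContinuousLinearMap.adjoint (flow S.adjointGen S.T)).comp
    (Phase.pairL (S.M.toEuclideanLin.toContinuousLinearMap.comp (Phase.sndL N)
        + S.C.toEuclideanLin.toContinuousLinearMap.comp (Phase.fstL N))
      (-(S.M.toEuclideanLin.toContinuousLinearMap.comp (Phase.fstL N)))))

theorem inner_terminal (y δ : Phase N) : inner ℝ (S.terminal y) δ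
    = -inner ℝ (WithLp.toLp 2 (S.M.toEuclideanLin y.snd + S.C.toEuclideanLin y.fst,
        -S.M.toEuclideanLin y.fst) : Phase N) (flow S.adjointGen S.T δ) := by
  change inner ℝ (-(ContinuousLinearMap.adjoint (flow S.adjointGen S.T) _)) δ = _
  rw [inner_neg_left, ContinuousLinearMap.adjoint_inner_left]
  rfl

/-- The adjoint flow is invertible, so `δ` can be chosen to make its final value equal to the vector
`z` built from `y`; then `z = 0`, and `y = 0` because `M` is injective and `z` is triangular in `y`.
-/
theorem terminal_injective : Function.Injective S.terminal := by
  rw [injective_iff_map_eq_zero]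
  intro y hy
  let z : Phase N := WithLp.toLp 2 (S.M.toEuclideanLin y.snd + S.C.toEuclideanLin y.fst,
        -S.M.toEuclideanLin y.fst)
  have h := S.inner_terminal y (flow S.adjointGen (-S.T) z)
  have h1 : flow S.adjointGen S.T (flow S.adjointGen (-S.T) z) = z :=
    congrArg (fun B : Phase N →L[ℝ] Phase N => B z) (flow_mul_flow_neg S.adjointGen S.T)
  rw [hy, inner_zero_left, h1] at h
  have hz : z = 0 := inner_self_eq_zero.1 (neg_eq_zero.1 h.symm)
  have hf : y.fst = 0 := by
    have h2 : -S.M.toEuclideanLin y.fst = 0 := congrArg WithLp.snd hz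
    exact S.M_injective (by rw [neg_eq_zero.1 h2, map_zero])
  have hs : y.snd = 0 := by
    have h2 : S.M.toEuclideanLin y.snd + S.C.toEuclideanLin y.fst = 0 := congrArg WithLp.fst hz
    rw [hf, map_zero, add_zero] at h2
    exact S.M_injective (by rw [h2, map_zero])
  exact Phase.ext hf hs

variable {S}

/-- This is the duality formula with the arbitrary `δ` removed. -/
theorem IsState.reach_sub {D : LoadData S.T N} {u : S.Control} {X V : ℝ → Vec N}
    (h : S.IsState D u X V) :
    S.reach u - S.loadVector D = S.terminal (WithLp.toLp 2 (X S.T, V S.T)) := by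
  refine ext_inner_right ℝ fun δ => ?_
  rw [inner_sub_left, inner_reach, S.isLoadVector_loadVector D δ, inner_terminal, Phase.inner_eq]
  have := h.duality δ
  simp only [WithLp.toLp_fst, WithLp.toLp_snd, inner_neg_left]
  linarith

theorem isExactControl_iff {D : LoadData S.T N} {u : S.Control} :
    S.IsExactControl D u ↔ S.reach u = S.loadVector D := by
  constructor
  · rintro ⟨X, V, h, hX, hV⟩
    rw [← sub_eq_zero, h.reach_sub, hX, hV]
    exact map_zero _
  · intro h
    obtain ⟨X, V, hs⟩ := S.exists_isState D u
    have h1 := hs.reach_sub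
    rw [h, sub_self] at h1
    have h2 := S.terminal_injective (h1.symm.trans (map_zero S.terminal).symm)
    exact ⟨X, V, hs, congrArg WithLp.fst h2, congrArg WithLp.snd h2⟩

variable (S)

/-- The inverse of `terminal`. -/
noncomputable def terminalInv : Phase N →L[ℝ] Phase N :=
  (exists_clm_leftInverse S.terminal_injective).choose

theorem terminalInv_terminal (y : Phase N) : S.terminalInv (S.terminal y) = y :=
  (exists_clm_leftInverse S.terminal_injective).choose_spec y

/-- With the state eliminated, the criterion is the squared norm of an affine continuous map plus
the cost, so continuity and strong convexity can be read off. -/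
theorem criterion_eq (D : LoadData S.T N) (ε α β γ : ℝ) (v : S.Control) :
    S.criterion D ε α β γ v
      = (‖S.terminalInv (S.reach v - S.loadVector D)‖ ^ 2 + ε * S.cost α β γ v) / 2 := by
  rw [(S.isState_state D v).reach_sub, terminalInv_terminal, WithLp.prod_norm_sq_eq_of_L2,
    criterion, WithLp.toLp_fst, WithLp.toLp_snd]
  ring

variable {S} {α β γ : ℝ}

theorem norm_sq_midpoint_le {E : Type*} [NormedAddCommGroup E] [NormedSpace ℝ E] (x y : E) :
    ‖(1 / 2 : ℝ) • x + (1 / 2 : ℝ) • y‖ ^ 2 ≤ (‖x‖ ^ 2 + ‖y‖ ^ 2) / 2 := by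
  have h : ‖(1 / 2 : ℝ) • x + (1 / 2 : ℝ) • y‖ ≤ (‖x‖ + ‖y‖) / 2 := by
    refine (norm_add_le _ _).trans (le_of_eq ?_)
    rw [norm_smul, norm_smul, Real.norm_of_nonneg (by norm_num)]
    ring
  have h2 := pow_le_pow_left₀ (norm_nonneg _) h 2
  nlinarith [sq_nonneg (‖x‖ - ‖y‖)]

theorem existsUnique_optimal (hα : 0 ≤ α) (hβ : 0 < β) (hγ : 0 ≤ γ) (D : LoadData S.T N) {ε : ℝ}
    (hε : 0 < ε) : ∃! u : S.Control, S.IsOptimal D ε α β γ u := by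
  obtain ⟨c, hc, hcoer⟩ := exists_energy_coercive S hα hβ
  -- The constant `ε c / 8` is the gain `c / 4` of the cost, times `ε`, times the factor `1 / 2` of
  -- the criterion.
  have hmid : ∀ x y : S.Control,
      S.criterion D ε α β γ ((1 / 2 : ℝ) • x + (1 / 2 : ℝ) • y)
        ≤ (S.criterion D ε α β γ x + S.criterion D ε α β γ y) / 2
          - ε * c / 8 * ‖x - y‖ ^ 2 := by
    intro x y
    have e : S.reach ((1 / 2 : ℝ) • x + (1 / 2 : ℝ) • y) - S.loadVector D
        = (1 / 2 : ℝ) • (S.reach x - S.loadVector D)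
          + (1 / 2 : ℝ) • (S.reach y - S.loadVector D) := by
      rw [map_add, map_smul, map_smul]
      module
    have h1 := norm_sq_midpoint_le (S.terminalInv (S.reach x - S.loadVector D))
      (S.terminalInv (S.reach y - S.loadVector D))
    have h2 := cost_midpoint_le (α := α) (β := β) hγ x y
    have h3 := hcoer (x - y)
    have h4 := mul_le_mul_of_nonneg_left h2 hε.le
    have h5 := mul_le_mul_of_nonneg_left h3 hε.le
    rw [criterion_eq, criterion_eq, criterion_eq, e, map_add, map_smul, map_smul]
    linarith
  have hcont : Continuous fun v => S.criterion D ε α β γ v := by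
    simp only [criterion_eq]
    have h1 : Continuous fun v => S.terminalInv (S.reach v - S.loadVector D) :=
      S.terminalInv.continuous.comp (S.reach.continuous.sub continuous_const)
    exact ((h1.norm.pow 2).add (continuous_const.mul continuous_cost)).div_const 2
  obtain ⟨u, -, hu⟩ := exists_minimizer_of_midpoint isClosed_univ convex_univ univ_nonempty hcont
    (b := 0) (fun v _ => by
      have := cost_nonneg (S := S) hα hβ.le hγ v
      simp only [criterion_eq]
      positivity) (by positivity : 0 < ε * c / 8) (fun x _ y _ => hmid x y)
  refine ⟨u, fun v => hu v (mem_univ v), fun w hw => ?_⟩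
  have h1 := hmid w u
  have h2 := hu ((1 / 2 : ℝ) • w + (1 / 2 : ℝ) • u) (mem_univ _)
  have h3 := hw u
  have h4 : ε * c / 8 * ‖w - u‖ ^ 2 ≤ 0 := by linarith
  have h5 : ‖w - u‖ ^ 2 ≤ 0 := by
    by_contra h
    push Not at h
    have : 0 < ε * c / 8 * ‖w - u‖ ^ 2 := by positivity
    linarith
  rw [← sub_eq_zero, ← norm_eq_zero]
  exact pow_eq_zero_iff two_ne_zero |>.1 (le_antisymm h5 (by positivity))

/-! ### The mixed problem -/

/-- The right-hand side of the mixed problem is `(Ψ, P v)`, so the problem is the Euler equation of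
`½ c - (Ψ, P ·)`. -/
theorem isMixedSolution_iff {Ψ : Phase N} {u : S.Control} {lam : Lp (Vec p) ⊤ (timeMeasure S.T)} :
    S.IsMixedSolution α β γ Ψ u lam ↔
      (∀ v, S.energy α β u v + γ * ∫ t, inner ℝ (lam t) (H10deriv v t) ∂(timeMeasure S.T)
        = inner ℝ Ψ (S.reach v)) ∧
      ∀ᵐ t ∂(timeMeasure S.T), ‖lam t‖ ≤ 1 ∧
        ∀ μ : Vec p, ‖μ‖ ≤ 1 → inner ℝ (μ - lam t) (H10deriv u t) ≤ 0 := by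
  refine and_congr_left fun h => forall_congr' fun v => ?_
  rw [integral_mixed_eq u v (h.mono fun t ht => ht.1), real_inner_comm, inner_reach]

/-- Quadratic growth of `½ c - (Ψ, P ·)` at the solution of the mixed problem. -/
theorem IsMixedSolution.growth (hγ : 0 ≤ γ) {Ψ : Phase N} {u : S.Control}
    {lam : Lp (Vec p) ⊤ (timeMeasure S.T)} (h : S.IsMixedSolution α β γ Ψ u lam) (v : S.Control) :
    S.cost α β γ u / 2 - inner ℝ Ψ (S.reach u) + S.energy α β (v - u) (v - u) / 2
      ≤ S.cost α β γ v / 2 - inner ℝ Ψ (S.reach v) := by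
  rw [isMixedSolution_iff] at h
  exact half_cost_growth hγ ((innerSL ℝ Ψ).comp S.reach).toLinearMap h.1 h.2 v

theorem IsMixedSolution.unique (hα : 0 ≤ α) (hβ : 0 < β) (hγ : 0 ≤ γ) {Ψ : Phase N}
    {u v : S.Control} {lam lam' : Lp (Vec p) ⊤ (timeMeasure S.T)}
    (h : S.IsMixedSolution α β γ Ψ u lam) (h' : S.IsMixedSolution α β γ Ψ v lam') : u = v := by
  have h1 := h.growth hγ v
  have h2 := h'.growth hγ u
  have h3 := le_energy_self (α := α) (β := β) hα (v - u)
  have h4 : 0 ≤ β * ‖H10deriv (v - u)‖ ^ 2 := by positivity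
  exact eq_of_energy_sub_nonpos (α := α) hα hβ (by linarith)

/-- Existence comes from minimizing `½ c - (Ψ, P ·)` over all controls and taking the multiplier
with `W = ⊤`. -/
theorem existsUnique_mixed (hα : 0 ≤ α) (hβ : 0 < β) (hγ : 0 < γ) (Ψ : Phase N) :
    ∃! u : S.Control, ∃ lam, S.IsMixedSolution α β γ Ψ u lam := by
  let l : S.Control →L[ℝ] ℝ := (innerSL ℝ Ψ).comp S.reach
  obtain ⟨u, -, hu⟩ := exists_minimizer_half_cost_sub hα hβ hγ.le l isClosed_univ convex_univ
    univ_nonempty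
  obtain ⟨lam, h1, h2⟩ := exists_multiplier (α := α) (β := β) hγ ⊤ l.toLinearMap u
    (fun w _ => hu (u + w) (mem_univ _))
  have hm : S.IsMixedSolution α β γ Ψ u lam :=
    isMixedSolution_iff.2 ⟨fun v => h1 v Submodule.mem_top, h2⟩
  exact ⟨u, ⟨lam, hm⟩, fun w ⟨lam', hw⟩ => hw.unique hα hβ hγ.le hm⟩

theorem exists_isMixedSolution_controlOf (hα : 0 ≤ α) (hβ : 0 < β) (hγ : 0 < γ) (Ψ : Phase N) :
    ∃ lam, S.IsMixedSolution α β γ Ψ (S.controlOf α β γ Ψ) lam :=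
  Classical.epsilon_spec (existsUnique_mixed hα hβ hγ Ψ).exists

/-- The exact control of minimal cost is of the form `u(Φ)`. -/
theorem exists_mixed_of_minimal_cost (hγ : 0 < γ) {u : S.Control}
    (hu : ∀ v, S.reach v = S.reach u → S.cost α β γ u ≤ S.cost α β γ v) :
    ∃ Φ lam, S.IsMixedSolution α β γ Φ u lam := by
  -- The admissible variations are those in `ker P`; along them the linear term is zero.
  obtain ⟨lam, h1, h2⟩ := exists_multiplier (α := α) (β := β) hγ (LinearMap.ker S.reach.toLinearMap)
    0 u (fun w hw => by
      have hw' : S.reach w = 0 := hw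
      have := hu (u + w) (by rw [map_add, hw', add_zero])
      simp only [LinearMap.zero_apply]
      linarith)
  have hi := fun w => integrable_inner_of_bound (h2.mono fun t ht => ht.1) w
  let R : S.Control →ₗ[ℝ] ℝ :=
    { toFun := fun w => S.energy α β u w
        + γ * ∫ t, inner ℝ (lam t) (H10deriv w t) ∂(timeMeasure S.T)
      map_add' := fun v w => by
        have e : ∫ t, inner ℝ (lam t) (H10deriv (v + w) t) ∂(timeMeasure S.T)
            = (∫ t, inner ℝ (lam t) (H10deriv v t) ∂(timeMeasure S.T))
              + ∫ t, inner ℝ (lam t) (H10deriv w t) ∂(timeMeasure S.T) := by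
          rw [← integral_add (hi _) (hi _)]
          refine integral_congr_ae ?_
          filter_upwards [Lp.coeFn_add (H10deriv v) (H10deriv w)] with t ht
          rw [← inner_add_right, ← Pi.add_apply, ← ht]
          rfl
        rw [energy_add_right, e]
        ring
      map_smul' := fun c w => by
        have e : ∫ t, inner ℝ (lam t) (H10deriv (c • w) t) ∂(timeMeasure S.T)
            = c * ∫ t, inner ℝ (lam t) (H10deriv w t) ∂(timeMeasure S.T) := by
          rw [← integral_const_mul]
          refine integral_congr_ae ?_
          filter_upwards [Lp.coeFn_smul c (H10deriv w)] with t ht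
          rw [← real_inner_smul_right, ← Pi.smul_apply, ← ht]
          rfl
        rw [energy_smul_right, e, RingHom.id_apply, smul_eq_mul]
        ring }
  -- The Euler form `R` is now defined on all controls and vanishes on `ker P`, so it is `(Φ, P ·)`
  -- for some `Φ`.
  obtain ⟨Φ, hΦ⟩ := exists_inner_eq_of_ker_le S.reach.toLinearMap R h1
  exact ⟨Φ, lam, isMixedSolution_iff.2 ⟨hΦ, h2⟩⟩

/-- A priori estimate for the optimal controls. -/
theorem IsOptimal.energy_sub_le (hα : 0 ≤ α) (hβ : 0 < β) (hγ : 0 ≤ γ) {D : LoadData S.T N}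
    {Φ : Phase N} {u₀ u : S.Control} {lam : Lp (Vec p) ⊤ (timeMeasure S.T)}
    (h₀ : S.IsMixedSolution α β γ Φ u₀ lam) (hu₀ : S.reach u₀ = S.loadVector D) {ε : ℝ}
    (hε : 0 < ε) (hu : S.IsOptimal D ε α β γ u) :
    S.energy α β (u - u₀) (u - u₀)
      ≤ 2 * (‖Φ‖ * (‖S.terminal‖ * Real.sqrt (ε * S.cost α β γ u₀))) := by
  have hs := (S.isState_state D u).reach_sub
  set y : Phase N := WithLp.toLp 2 ((S.state D u).1 S.T, (S.state D u).2 S.T)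
  -- The exact control `u₀` is the competitor: its final state is zero, so its criterion is `ε c(u₀)
  -- / 2`, which bounds both the final state `y` and the cost of `u`.
  have h1 := hu u₀
  rw [criterion_eq, criterion_eq, hs, terminalInv_terminal, hu₀, sub_self, map_zero, norm_zero]
    at h1
  have hc := cost_nonneg (S := S) hα hβ.le hγ u
  have h2 : ‖y‖ ≤ Real.sqrt (ε * S.cost α β γ u₀) := by
    apply Real.le_sqrt_of_sq_le
    have := mul_nonneg hε.le hc
    linarith
  have h3 : S.cost α β γ u ≤ S.cost α β γ u₀ := by
    have : 0 ≤ ‖y‖ ^ 2 := by positivity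
    refine le_of_mul_le_mul_left (a := ε) ?_ hε
    linarith
  -- As `c(u) ≤ c(u₀)`, growth leaves only the linear term `(Φ, P u₀ - P u) = -(Φ, terminal y)`,
  -- which is of order `√ε`.
  have h4 := h₀.growth hγ u
  have h5 : inner ℝ Φ (S.reach u) = inner ℝ Φ (S.reach u₀) + inner ℝ Φ (S.terminal y) := by
    rw [← inner_add_right, ← hs, hu₀, add_sub_cancel]
  have h6 : -inner ℝ Φ (S.terminal y)
      ≤ ‖Φ‖ * (‖S.terminal‖ * Real.sqrt (ε * S.cost α β γ u₀)) := by
    refine (neg_le_abs _).trans ((abs_real_inner_le_norm _ _).trans ?_)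
    gcongr
    exact (S.terminal.le_opNorm y).trans (by gcongr)
  linarith

end ControlSystem

/-! ### The main theorem. -/

theorem mainTheorem1 {N p : ℕ} (S : ControlSystem N p) (D : LoadData S.T N)
    (α β γ : ℝ) (hα : 0 ≤ α) (hβ : 0 < β) (hγ : 0 < γ)
    (hcontr : S.ExactlyControllable) :
    -- the state equation, the adjoint equation and the mixed problem are well posed
    (∀ v : S.Control, ∃ X V : ℝ → Vec N, S.IsState D v X V ∧
      ∀ X' V' : ℝ → Vec N, S.IsState D v X' V' →
        EqOn X' X (Icc 0 S.T) ∧ EqOn V' V (Icc 0 S.T)) ∧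
    (∀ Ψ : WithLp 2 (Vec N × Vec N), ∃! Q : ℝ → Vec N, S.IsAdjoint Ψ Q) ∧
    (∀ Ψ : WithLp 2 (Vec N × Vec N),
      ∃! u : S.Control, ∃ lam, S.IsMixedSolution α β γ Ψ u lam) ∧
    -- each optimal control problem has exactly one solution
    (∀ ε : ℝ, 0 < ε → ∃! u : S.Control, S.IsOptimal D ε α β γ u) ∧
    ∃ (Λ : WithLp 2 (Vec N × Vec N) → WithLp 2 (Vec N × Vec N))
      (L : WithLp 2 (Vec N × Vec N)) (u₀ : S.Control),
      S.IsLambda α β γ Λ ∧ S.IsLoadVector D L ∧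
      -- `u₀ = u(Φ)` with `Λ(Φ) = L`
      (∃ Φ, Λ Φ = L) ∧ (∀ Φ, Λ Φ = L → S.controlOf α β γ Φ = u₀) ∧
      -- `u₀` is an exact control, and the only one of minimal cost
      S.IsExactControl D u₀ ∧
      (∀ v : S.Control, S.IsExactControl D v → v ≠ u₀ → S.cost α β γ u₀ < S.cost α β γ v) ∧
      -- strong convergence of the optimal controls
      ∀ uε : ℝ → S.Control, (∀ ε : ℝ, 0 < ε → S.IsOptimal D ε α β γ (uε ε)) →
        Tendsto uε (𝓝[>] 0) (𝓝 u₀) := by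
  obtain ⟨w, hw⟩ := hcontr D
  obtain ⟨u₀, hu₀, hmin⟩ := ControlSystem.exists_minimizer_half_cost_sub (S := S) hα hβ hγ.le 0
    (A := {v | S.reach v = S.loadVector D})
    (isClosed_eq S.reach.continuous continuous_const)
    (fun x hx y hy a b _ _ hab => by
      change S.reach (a • x + b • y) = _
      rw [map_add, map_smul, map_smul, hx, hy, ← add_smul, hab, one_smul])
    ⟨w, ControlSystem.isExactControl_iff.1 hw⟩
  have hr₀ : S.reach u₀ = S.loadVector D := hu₀
  have hmin' : ∀ v, S.reach v = S.loadVector D → S.cost α β γ u₀ ≤ S.cost α β γ v := fun v hv => by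
    have := hmin v hv
    simp only [zero_apply] at this
    linarith
  obtain ⟨Φ, lam, hΦ⟩ := ControlSystem.exists_mixed_of_minimal_cost (α := α) (β := β) hγ
    (u := u₀) (fun v hv => hmin' v (hv.trans hr₀))
  have hspec := ControlSystem.exists_isMixedSolution_controlOf (S := S) hα hβ hγ
  refine ⟨fun v => ?_, S.existsUnique_adjoint,
    ControlSystem.existsUnique_mixed hα hβ hγ,
    fun ε hε => ControlSystem.existsUnique_optimal hα hβ hγ.le D hε,
    fun Ψ => S.reach (S.controlOf α β γ Ψ), S.loadVector D, u₀,
    fun Ψ δ => S.inner_reach _ δ, S.isLoadVector_loadVector D, ⟨Φ, ?_⟩, fun Φ' hΦ' => ?_,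
    ControlSystem.isExactControl_iff.2 hr₀, fun v hv hne => ?_, fun uε huε => ?_⟩
  · obtain ⟨X, V, h⟩ := S.exists_isState D v
    exact ⟨X, V, h, fun X' V' h' => h.unique h'⟩
  · obtain ⟨lam', h'⟩ := hspec Φ
    change S.reach (S.controlOf α β γ Φ) = _
    rw [h'.unique hα hβ hγ.le hΦ, hr₀]
  · obtain ⟨lam', h'⟩ := hspec Φ'
    have hr : S.reach (S.controlOf α β γ Φ') = S.loadVector D := hΦ'
    -- Both `u(Φ')` and `u₀` satisfy `P v = L`, so the linear terms cancel and the minimality of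
    -- `u₀` forces the energy of the difference to vanish.
    have h1 := h'.growth hγ.le u₀
    rw [hr, hr₀] at h1
    have h2 := hmin' _ hr
    exact (ControlSystem.eq_of_energy_sub_nonpos (α := α) hα hβ (by linarith)).symm
  · have h1 := hΦ.growth hγ.le v
    rw [ControlSystem.isExactControl_iff.1 hv, hr₀] at h1
    by_contra hlt
    push Not at hlt
    exact hne (ControlSystem.eq_of_energy_sub_nonpos (α := α) hα hβ (by linarith))
  · obtain ⟨c, hc, hcoer⟩ := ControlSystem.exists_energy_coercive S hα hβ
    -- Coercivity turns the energy estimate into the norm bound `b`, of order `ε^(1/4)`.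
    let b : ℝ → ℝ := fun ε =>
      Real.sqrt (2 * (‖Φ‖ * (‖S.terminal‖ * Real.sqrt (ε * S.cost α β γ u₀))) / c)
    have hb : Tendsto b (𝓝[>] 0) (𝓝 0) := by
      have h1 : Continuous b := by fun_prop
      have h2 : b 0 = 0 := by simp [b]
      have h3 := h1.tendsto 0
      rw [h2] at h3
      exact h3.mono_left nhdsWithin_le_nhds
    rw [tendsto_iff_norm_sub_tendsto_zero]
    refine squeeze_zero' (Eventually.of_forall fun _ => norm_nonneg _) ?_ hb
    filter_upwards [self_mem_nhdsWithin] with ε hε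
    have h1 := (huε ε hε).energy_sub_le hα hβ hγ.le hΦ hr₀ hε
    apply Real.le_sqrt_of_sq_le
    rw [le_div_iff₀ hc, mul_comm]
    exact (hcoer _).trans h1
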